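/- **Setting.** The stream consists of updates $(i,\Delta)$, $i\in[n]$, $\Delta\in\mathbb Z$, to a vector $x\in\mathbb Z^n$ (initially $0$) that always stays in $\{-N,\dots,N\}^n$, $N=N(n)\in\mathrm{poly}(n)$; $1\le k=k(n)\le n$. $\tilde O(f)$ means $f\cdot\mathrm{poly}(\log n)$. Running time and space are measured on a random access machine with logarithmic (bit) cost, running one program for all $n$ on the stored data structure. Let $\mathsf{StreamAlg}_0$ be a streaming algorithm for relaxed $k$-sparse recovery: its $\mathsf{Report}$ always outputs a vector $x'\in\mathbb Z^n$ with $\mathrm{poly}(n)$-bounded entries, given as the list of its non-zero coordinates, and $x'=x$ whenever $\|x\|_0\le k$. **Construction 1, instantiated with the GSW scheme.** Let $\lambda$ be the security parameter, $g=\lambda$ the lattice dimension, $q\in\mathrm{poly}(n)$ with $q>nN$ the modulus, $L=\lceil\log_2 q\rceil$, and $h\in\Theta(g\log q)$ with $h\ge (g+1)L$. Let $G=I_{g+1}\otimes(1,2,\dots,2^{L-1})$, padded by zero columns to $h$ columns, and let $G^{-1}(C)$ be the bit decomposition of $C$, a $0/1$ matrix with $G\,G^{-1}(C)=C$. Homomorphic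 evaluation of a Boolean circuit replaces the constant $1$ by $G$, negation by $C\mapsto G-C$ and conjunction by $(C,D)\mapsto C\cdot G^{-1}(D)$. Put $\ell=\lceil\log_2 n\rceil$, and let $C_i$ be the circuit testing whether $\ell$ input bits are the binary digits of the coordinate $i$. * $\mathsf{Setup}$: run $\mathsf{StreamAlg}_0.\mathsf{Setup}$, draw $\widetilde{pk},\widetilde{ct}_1,\dots,\widetilde{ct}_\ell$ uniformly from $\mathbb Z_q^{(g+1)\times h}$, put $sketch=0$. * $\mathsf{Update}(i,\Delta)$: run $\mathsf{StreamAlg}_0.\mathsf{Update}(i,\Delta)$, evaluate $\widehat{ct}_i=\mathsf{Eval}(\widetilde{pk},C_i,\widetilde{ct}_1,\dots,\widetilde{ct}_\ell)$, and put $sketch\leftarrow sketch+\Delta\cdot\widehat{ct}_i \bmod q$. * $\mathsf{Report}$: let $x'\leftarrow\mathsf{StreamAlg}_0.\mathsf{Report}$. Output $\bot$ if $\|x'\|_0>k$; otherwise output $x'$ if $\sum_i x'_i\,\widehat{ct}_i=sketch$ modulo $q$, and $\bot$ otherwise. **Proposition 4.6.** In the parameter regime for polynomial hardness of LWE, $\lambda=\lceil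 n^w\rceil$ with an arbitrarily small constant $w>0$, the following holds (the hardness assumption motivates this choice of $\lambda$; the bounds themselves need no assumption). For all $w_1,w_2,w_3>0$ there is $w_0>0$ such that for every $w\in(0,w_0]$, $\mathsf{Update}$ and $\mathsf{Report}$ of Construction 1 can be implemented so that, at all times and for every outcome of $\mathsf{Setup}$: 1. $(\widetilde{pk},\widetilde{ct}_1,\dots,\widetilde{ct}_{\ell})$ and $sketch$ are stored in $\tilde O(n^{w_1})$ bits; 2. the running time of $\mathsf{Update}$ is at most $\tilde O(n^{w_2})$ plus that of the call of $\mathsf{StreamAlg}_0.\mathsf{Update}$; 3. the running time of $\mathsf{Report}$ is at most $\tilde O(k\cdot n^{w_3})$ plus that of the call of $\mathsf{StreamAlg}_0.\mathsf{Report}$. -/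

import Mathlib

namespace WARStream

/-! ### Random access machine with logarithmic cost

Memory consists of banks (arrays) named by the elements of a type `B`; a program mentions finitely
many of them. Every cell holds an integer. Programs are built from assignments, sequencing,
conditionals and while loops, with indirect addressing inside a bank. Each operation is charged by
the bit lengths of its operands; multiplication and division are charged the product of the bit
lengths. -/

/-- Bit length of an integer. -/
def bitLen (z : ℤ) : ℕ := Nat.size z.natAbs

/-- A memory: bank, address, content. -/
abbrev Mem (B : Type) : Type := B → ℤ → ℤ

inductive Op where
  | add | sub | mul | div | mod | eq | lt

/-- Value of an operation; the comparisons return `1` or `0`. -/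
def Op.val : Op → ℤ → ℤ → ℤ
  | .add, x, y => x + y
  | .sub, x, y => x - y
  | .mul, x, y => x * y
  | .div, x, y => x / y
  | .mod, x, y => x % y
  | .eq, x, y => if x = y then 1 else 0
  | .lt, x, y => if x < y then 1 else 0

/-- Bit cost of an operation. -/
def Op.cost : Op → ℤ → ℤ → ℕ
  | .mul, x, y => (bitLen x + 1) * (bitLen y + 1)
  | .div, x, y => (bitLen x + 1) * (bitLen y + 1)
  | .mod, x, y => (bitLen x + 1) * (bitLen y + 1)
  | _, x, y => bitLen x + bitLen y + 1

inductive Expr (B : Type) where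
  | const (c : ℤ)
  | load (b : B) (addr : Expr B)
  | bin (o : Op) (e₁ e₂ : Expr B)

def Expr.val {B : Type} (σ : Mem B) : Expr B → ℤ
  | .const c => c
  | .load b e => σ b (e.val σ)
  | .bin o e₁ e₂ => o.val (e₁.val σ) (e₂.val σ)

def Expr.cost {B : Type} (σ : Mem B) : Expr B → ℕ
  | .const c => bitLen c + 1
  | .load b e => e.cost σ + bitLen (e.val σ) + bitLen (σ b (e.val σ)) + 1
  | .bin o e₁ e₂ => e₁.cost σ + e₂.cost σ + o.cost (e₁.val σ) (e₂.val σ)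

inductive Prog (B : Type) where
  | skip
  | store (b : B) (addr value : Expr B)
  | seq (p₁ p₂ : Prog B)
  | ite (c : Expr B) (p₁ p₂ : Prog B)
  | loop (c : Expr B) (p : Prog B)

/-- Overwrite one cell. -/
def Mem.write {B : Type} [DecidableEq B] (σ : Mem B) (b : B) (a v : ℤ) : Mem B :=
  Function.update σ b (Function.update (σ b) a v)

/-- `Exec p σ τ t`: started on the memory `σ`, the program `p` halts with the memory `τ`, and the
total cost of the run is `t`. -/
inductive Exec {B : Type} [DecidableEq B] : Prog B → Mem B → Mem B → ℕ → Prop where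
  | skip (σ : Mem B) : Exec .skip σ σ 0
  | store (σ : Mem B) (b : B) (e v : Expr B) :
      Exec (.store b e v) σ (σ.write b (e.val σ) (v.val σ))
        (e.cost σ + v.cost σ + bitLen (e.val σ) + bitLen (v.val σ) + 1)
  | seq {p₁ p₂ : Prog B} {σ τ ρ : Mem B} {t₁ t₂ : ℕ} :
      Exec p₁ σ τ t₁ → Exec p₂ τ ρ t₂ → Exec (.seq p₁ p₂) σ ρ (t₁ + t₂)
  | ite_true {c : Expr B} {p₁ p₂ : Prog B} {σ τ : Mem B} {t : ℕ} :
      c.val σ ≠ 0 → Exec p₁ σ τ t → Exec (.ite c p₁ p₂) σ τ (c.cost σ + 1 + t)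
  | ite_false {c : Expr B} {p₁ p₂ : Prog B} {σ τ : Mem B} {t : ℕ} :
      c.val σ = 0 → Exec p₂ σ τ t → Exec (.ite c p₁ p₂) σ τ (c.cost σ + 1 + t)
  | loop_done {c : Expr B} {p : Prog B} {σ : Mem B} :
      c.val σ = 0 → Exec (.loop c p) σ σ (c.cost σ + 1)
  | loop_step {c : Expr B} {p : Prog B} {σ τ ρ : Mem B} {t₁ t₂ : ℕ} :
      c.val σ ≠ 0 → Exec p σ τ t₁ → Exec (.loop c p) τ ρ t₂ →
      Exec (.loop c p) σ ρ (c.cost σ + 1 + t₁ + t₂)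

/-! ### Streams and streaming algorithms -/

/-- All coordinates of the vector lie in `{-N, …, N}`. -/
def Bounded {n : ℕ} (N : ℕ) (x : Fin n → ℤ) : Prop := ∀ i, |x i| ≤ (N : ℤ)

/-- The memory banks of the underlying relaxed recovery algorithm. -/
inductive Bank₀ where
  | input
  | output
  | priv (b : ℕ)
  deriving DecidableEq

/-- Place an update `(i, Δ)` in the first two cells of the input bank `b`. -/
def writeInput {B : Type} [DecidableEq B] (b : B) (σ : Mem B) (i Δ : ℤ) : Mem B :=
  (σ.write b 0 i).write b 1 Δ

/-- The cells `c` hold the vector `x` in sparse form: the number of non-zero coordinates, followed by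
the pairs (coordinate, value) of the non-zero coordinates in some order, without repetition. -/
def HoldsSparse {n : ℕ} (c : ℤ → ℤ) (x : Fin n → ℤ) : Prop :=
  ∃ (m : ℕ) (e : Fin m → Fin n), Function.Injective e ∧ (∀ i, x i ≠ 0 ↔ ∃ r, e r = i) ∧
    c 0 = m ∧ ∀ r : Fin m, c (2 * (r : ℤ) + 1) = ((e r : ℕ) : ℤ) ∧ c (2 * (r : ℤ) + 2) = x (e r)

/-- A response is a sparse vector or `⊥` (`none`), the latter being signalled by the count `-1`. -/
def HoldsResponse {n : ℕ} (c : ℤ → ℤ) : Option (Fin n → ℤ) → Prop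
  | none => c 0 = -1
  | some x => HoldsSparse c x

/-- A streaming algorithm: the memory produced by its setup in dimension `n`, and its programs for
updates and reports (the same programs for all `n`). -/
structure StreamAlg₀ where
  init : ℕ → Mem Bank₀
  update : Prog Bank₀
  report : Prog Bank₀

/-- `A.Reach n N x σ`: starting from setup, some sequence of updates and reports, along which the
underlying vector stays in `{-N, …, N}ⁿ`, leads to the underlying vector `x` and the memory `σ`. -/
inductive StreamAlg₀.Reach (A : StreamAlg₀) (n N : ℕ) : (Fin n → ℤ) → Mem Bank₀ → Prop where
  | setup : Reach A n N 0 (A.init n)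
  | update {x : Fin n → ℤ} {σ σ' : Mem Bank₀} {t : ℕ} (i : Fin n) (Δ : ℤ) :
      Reach A n N x σ → Bounded N (x + Pi.single i Δ) →
      Exec A.update (writeInput .input σ (i : ℕ) Δ) σ' t → Reach A n N (x + Pi.single i Δ) σ'
  | report {x : Fin n → ℤ} {σ σ' : Mem Bank₀} {t : ℕ} :
      Reach A n N x σ → Exec A.report σ σ' t → Reach A n N x σ'

/-- `A` solves relaxed `k`-sparse recovery in dimension `n` on streams bounded by `N`: updates and
reports always halt, a report always outputs an integer vector (with entries of absolute value at
most `M`), and this vector is the underlying one whenever the latter is `k`-sparse. -/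
structure StreamAlg₀.SolvesRelaxed (A : StreamAlg₀) (n k N M : ℕ) : Prop where
  update_halts : ∀ x σ, A.Reach n N x σ → ∀ (i : Fin n) (Δ : ℤ), Bounded N (x + Pi.single i Δ) →
    ∃ σ' t, Exec A.update (writeInput .input σ (i : ℕ) Δ) σ' t
  report_halts : ∀ x σ, A.Reach n N x σ → ∃ (σ' : Mem Bank₀) (t : ℕ) (x' : Fin n → ℤ),
    Exec A.report σ σ' t ∧ HoldsSparse (σ' .output) x' ∧ Bounded M x' ∧
      (hammingNorm x ≤ k → x' = x)

/-! ### The GSW scheme: ciphertexts and homomorphic evaluation -/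

/-- Boolean circuits with `l` inputs. -/
inductive Circuit (l : ℕ) where
  | const (b : Bool)
  | input (j : Fin l)
  | not (c : Circuit l)
  | and (c d : Circuit l)

def Circuit.eval {l : ℕ} (μ : Fin l → Bool) : Circuit l → Bool
  | .const b => b
  | .input j => μ j
  | .not c => !(c.eval μ)
  | .and c d => c.eval μ && d.eval μ

/-- The circuit that tests whether the input bits are the binary digits of `i`. -/
def pointCircuit (l i : ℕ) : Circuit l :=
  (List.finRange l).foldr
    (fun (j : Fin l) c => .and (if i.testBit (j : ℕ) then .input j else .not (.input j)) c) (.const true)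

theorem pointCircuit_eval (l i : ℕ) (μ : Fin l → Bool) :
    (pointCircuit l i).eval μ = true ↔ ∀ j : Fin l, μ j = i.testBit (j : ℕ) := by
  have key : ∀ L : List (Fin l), (L.foldr
      (fun (j : Fin l) c => Circuit.and (if i.testBit (j : ℕ) then .input j else .not (.input j)) c)
      (.const true)).eval μ = true ↔ ∀ j ∈ L, μ j = i.testBit (j : ℕ) := by
    intro L
    induction L with
    | nil => simp [Circuit.eval]
    | cons a L ih =>
      rw [List.foldr_cons, Circuit.eval, Bool.and_eq_true, ih]
      by_cases h : i.testBit (a : ℕ) <;> simp [h, Circuit.eval]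
  simpa [pointCircuit] using key (List.finRange l)

/-- The ciphertexts (and public keys): `(g + 1) × h` matrices over `ℤ_q`. -/
abbrev Ct (q g h : ℕ) : Type := Matrix (Fin (g + 1)) (Fin h) (ZMod q)

/-- The gadget matrix `I ⊗ (1, 2, 4, …, 2^(L-1))` with `L = ⌈log₂ q⌉`, padded by zero columns. -/
def gadget (q g h : ℕ) : Ct q g h := fun a j =>
  if (j : ℕ) / Nat.clog 2 q = a then 2 ^ ((j : ℕ) % Nat.clog 2 q) else 0

/-- Bit decomposition: the `0/1` matrix with `gadget * gadgetInv C = C`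
(when `(g + 1) * ⌈log₂ q⌉ ≤ h`). -/
def gadgetInv {q g h : ℕ} (C : Ct q g h) : Matrix (Fin h) (Fin h) (ZMod q) := fun j c =>
  if hj : (j : ℕ) / Nat.clog 2 q < g + 1 then
    if (C ⟨(j : ℕ) / Nat.clog 2 q, hj⟩ c).val.testBit ((j : ℕ) % Nat.clog 2 q) then 1 else 0
  else 0

/-- Homomorphic evaluation of a circuit. -/
def gswEval {q g h l : ℕ} (_pk : Ct q g h) (ct : Fin l → Ct q g h) : Circuit l → Ct q g h
  | .const b => if b then gadget q g h else 0
  | .input j => ct j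
  | .not c => gadget q g h - gswEval _pk ct c
  | .and c d => gswEval _pk ct c * gadgetInv (gswEval _pk ct d)

/-! ### The robust streaming algorithm -/

/-- The data structure: the data structure of the relaxed recovery algorithm, the pseudo-public key,
`⌈log₂ n⌉` pseudo-ciphertexts and the sketch. -/
structure DS (n q g h : ℕ) where
  sub : Mem Bank₀
  pk : Ct q g h
  ct : Fin (Nat.clog 2 n) → Ct q g h
  sketch : Ct q g h

/-- The evaluated ciphertext of the coordinate `i` (numbered from `0`). -/
def DS.ctHat {n q g h : ℕ} (s : DS n q g h) (i : Fin n) : Ct q g h :=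
  gswEval s.pk s.ct (pointCircuit (Nat.clog 2 n) i)

/-- Setup: the pseudo-public key and the pseudo-ciphertexts are sampled uniformly, so that every
value of `pk` and `ct` is a possible outcome; the sketch is `0`. -/
def SetupStep (A : StreamAlg₀) {n q g h : ℕ} (s : DS n q g h) : Prop :=
  s.sub = A.init n ∧ s.sketch = 0

/-- `Update(i, Δ)` turns `s` into `s'`, where the call of the relaxed recovery algorithm's update
costs `t₀`. -/
def UpdateStep (A : StreamAlg₀) {n q g h : ℕ} (s : DS n q g h) (i : Fin n) (Δ : ℤ)
    (s' : DS n q g h) (t₀ : ℕ) : Prop :=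
  Exec A.update (writeInput .input s.sub (i : ℕ) Δ) s'.sub t₀ ∧
    s'.pk = s.pk ∧ s'.ct = s.ct ∧ s'.sketch = s.sketch + Δ • s.ctHat i

/-- `Report()` turns `s` into `s'` and responds `r`, where the call of the relaxed recovery
algorithm's report costs `t₀`. -/
def ReportStep (A : StreamAlg₀) (k : ℕ) {n q g h : ℕ} (s s' : DS n q g h)
    (r : Option (Fin n → ℤ)) (t₀ : ℕ) : Prop :=
  Exec A.report s.sub s'.sub t₀ ∧ s'.pk = s.pk ∧ s'.ct = s.ct ∧ s'.sketch = s.sketch ∧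
    ∃ x' : Fin n → ℤ, HoldsSparse (s'.sub .output) x' ∧
      r = if k < hammingNorm x' then none
          else if ∑ i, x' i • s.ctHat i = s.sketch then some x' else none

/-- The states of the robust algorithm that can occur, together with the underlying vector, on streams
bounded by `N`. -/
inductive Reach (A : StreamAlg₀) (k N : ℕ) {n q g h : ℕ} :
    (Fin n → ℤ) → DS n q g h → Prop where
  | setup {s : DS n q g h} : SetupStep A s → Reach A k N 0 s
  | update {x : Fin n → ℤ} {s s' : DS n q g h} {t : ℕ} (i : Fin n) (Δ : ℤ) :
      Reach A k N x s → Bounded N (x + Pi.single i Δ) → UpdateStep A s i Δ s' t →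
      Reach A k N (x + Pi.single i Δ) s'
  | report {x : Fin n → ℤ} {s s' : DS n q g h} {r : Option (Fin n → ℤ)} {t : ℕ} :
      Reach A k N x s → ReportStep A k s s' r t → Reach A k N x s'

/-- The memory banks of the robust algorithm. -/
inductive Bank where
  | sub (b : Bank₀)
  | input
  | output
  | param
  | pk
  | ct
  | sketch
  | work (b : ℕ)
  deriving DecidableEq

/-- The memory `σ` holds the data structure `s` (and the parameters); residues modulo `q` are stored as
integers in `{0, …, q-1}`, matrices row by row. The input, output and working banks are
unconstrained, so nothing can be kept there between operations. -/
structure Holds (k : ℕ) {n q g h : ℕ} (σ : Mem Bank) (s : DS n q g h) : Prop where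
  sub : ∀ b, σ (.sub b) = s.sub b
  dim : σ .param 0 = n
  sparsity : σ .param 1 = k
  modulus : σ .param 2 = q
  latticeDim : σ .param 3 = g
  columns : σ .param 4 = h
  log_dim : σ .param 5 = Nat.clog 2 n
  log_modulus : σ .param 6 = Nat.clog 2 q
  pk : ∀ (a : Fin (g + 1)) (c : Fin h), σ .pk ((a * h + c : ℕ) : ℤ) = (s.pk a c).val
  ct : ∀ (j : Fin (Nat.clog 2 n)) (a : Fin (g + 1)) (c : Fin h),
    σ .ct ((j * ((g + 1) * h) + (a * h + c) : ℕ) : ℤ) = (s.ct j a c).val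
  sketch : ∀ (a : Fin (g + 1)) (c : Fin h),
    σ .sketch ((a * h + c : ℕ) : ℤ) = (s.sketch a c).val

/-- Bits occupied by the first `m` cells of a bank: address and content of each cell. -/
def cellBits (c : ℤ → ℤ) (m : ℕ) : ℕ :=
  ∑ a ∈ Finset.range m, (bitLen a + bitLen (c a) + 1)

/-- Bits occupied by the public key, the `⌈log₂ n⌉` ciphertexts, the sketch and the parameters. -/
def storedBits (n g h : ℕ) (σ : Mem Bank) : ℕ :=
  cellBits (σ .pk) ((g + 1) * h) + cellBits (σ .ct) (Nat.clog 2 n * ((g + 1) * h)) +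
    cellBits (σ .sketch) ((g + 1) * h) + cellBits (σ .param) 7

/-! ### Asymptotics -/

/-- `f ∈ poly(n)`. -/
def PolyBounded (f : ℕ → ℕ) : Prop := ∃ c : ℕ, ∀ n, f n ≤ n ^ c + c

/-- `f ∈ Õ(F)`, that is, `f ≤ F · poly(log n)` for large `n`. -/
def SoftO (f : ℕ → ℕ) (F : ℕ → ℝ) : Prop :=
  ∃ (C : ℝ) (d : ℕ), ∀ᶠ n : ℕ in Filter.atTop, (f n : ℝ) ≤ C * F n * Real.log n ^ d

end WARStream

open WARStream Filter Asymptotics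

namespace WARStream

/-! ### Bit lengths -/

/-! The bounds come from an instruction count times a polylogarithmic price per instruction. Outside
the calls of the relaxed algorithm, every constant and every loaded cell is at most some `b`
polynomial in `n`: residues are reduced modulo `q` before being stored, and the remaining numbers
are parameters, addresses, powers of two, `Δ` and reported entries. An expression of bounded size
over such loads costs `O(log² b)` (`Expr.cost_le`), so `Runs` only has to count instructions, priced
by `unitCost b`; `EventuallyPoly.softO_size` turns that price into `poly(log n)`.

Evaluated ciphertexts are not kept but recomputed from the coordinate. The point circuit is a
right-nested conjunction of `⌈log₂ n⌉` literals. Its evaluation therefore starts from the gadget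
matrix `G` and makes one round per input bit, from the last bit to the first, each multiplying the
ciphertext of a literal by the bit decomposition of the current result (`runs_evalProg`). With `L =
⌈log₂ q⌉`, such a product has `(g+1)h` entries, each a sum of `(g+1)L` terms (`flat_mul_gadgetInv`).
As `g ≈ n^w` and `h = O(g log q)`, an evaluation takes `Õ(n^{3w})` instructions, and a third of the
least target exponent serves as `w₀`.

An update is one evaluation and one scaled matrix addition. A report rejects a list longer than `k`
before evaluating anything, so it makes at most `k` evaluations. Storage consists of `⌈log₂ n⌉ + 2`
matrices, hence `Õ(n^{2w})` bits. The relaxed algorithm runs in its own renamed banks at unchanged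
cost (`Exec.map`), so its cost enters as a separate summand. The argument treats an arbitrary fixed
outcome of setup; no probability is involved. -/

theorem bitLen_le_iff {z : ℤ} {b : ℕ} : bitLen z ≤ b ↔ z.natAbs < 2 ^ b := Nat.size_le

theorem natAbs_lt_bitLen (z : ℤ) : z.natAbs < 2 ^ bitLen z := Nat.lt_size_self _

theorem bitLen_le_size {z : ℤ} {b : ℕ} (h : |z| ≤ b) : bitLen z ≤ Nat.size b :=
  Nat.size_le_size (by rw [Int.abs_eq_natAbs] at h; exact_mod_cast h)

/-- One crude bound serves all operations, since the product dominates the sum, the product and both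
operands. Reduction modulo `0` returns the dividend, which it also covers. -/
theorem Op.natAbs_val_le (o : Op) (x y : ℤ) :
    (o.val x y).natAbs ≤ (x.natAbs + 1) * (y.natAbs + 1) := by
  have key : ∀ a b : ℕ, a + b + 1 + a * b = (a + 1) * (b + 1) := fun a b => by ring
  have h0 : x.natAbs ≤ (x.natAbs + 1) * (y.natAbs + 1) := by rw [← key]; omega
  have h1 : x.natAbs + y.natAbs + 1 ≤ (x.natAbs + 1) * (y.natAbs + 1) := by rw [← key]; omega
  cases o with
  | add => exact (Int.natAbs_add_le x y).trans (by omega)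
  | sub => exact (Int.natAbs_sub_le x y).trans (by omega)
  | mul => simp only [Op.val, Int.natAbs_mul]; rw [← key]; omega
  | div =>
    have := Int.natAbs_ediv_le_natAbs x y
    exact this.trans h0
  | mod =>
    simp only [Op.val]
    rcases eq_or_ne y 0 with rfl | hy
    · simp
    · have h2 := Int.emod_nonneg x hy
      have h3 := Int.emod_lt_abs x hy
      rw [Int.abs_eq_natAbs] at h3
      omega
  | eq => simp only [Op.val]; split_ifs <;> simp; omega
  | lt => simp only [Op.val]; split_ifs <;> simp; omega

theorem Op.bitLen_val_le (o : Op) (x y : ℤ) :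
    bitLen (o.val x y) ≤ bitLen x + bitLen y + 1 := by
  by_cases hx : x = 0
  · subst hx
    rw [bitLen_le_iff]
    have hy := natAbs_lt_bitLen y
    have h1 : 1 ≤ 2 ^ bitLen y := Nat.one_le_two_pow
    have : (o.val 0 y).natAbs ≤ y.natAbs + 1 := by simpa using o.natAbs_val_le 0 y
    simp only [bitLen, Int.natAbs_zero, Nat.size_zero, zero_add, pow_succ] at *
    omega
  · by_cases hy : y = 0
    · subst hy
      rw [bitLen_le_iff]
      have hx := natAbs_lt_bitLen x
      have h1 : 1 ≤ 2 ^ bitLen x := Nat.one_le_two_pow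
      have : (o.val x 0).natAbs ≤ x.natAbs + 1 := by simpa using o.natAbs_val_le x 0
      simp only [bitLen, Int.natAbs_zero, Nat.size_zero, add_zero, pow_succ] at *
      omega
    · rw [bitLen_le_iff]
      have h1 := natAbs_lt_bitLen x
      have h2 := natAbs_lt_bitLen y
      calc (o.val x y).natAbs ≤ (x.natAbs + 1) * (y.natAbs + 1) := o.natAbs_val_le x y
        _ ≤ 2 ^ bitLen x * 2 ^ bitLen y := Nat.mul_le_mul h1 h2
        _ < 2 ^ (bitLen x + bitLen y + 1) := by
          rw [← pow_add, pow_succ]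
          have : 0 < 2 ^ (bitLen x + bitLen y) := by positivity
          omega

/-! ### Cost of expressions -/

section Framework

variable {B : Type}

/-- Number of nodes of an expression. -/
def Expr.size : Expr B → ℕ
  | .const _ => 1
  | .load _ e => e.size + 1
  | .bin _ e₁ e₂ => e₁.size + e₂.size + 1

/-- All constants and all values loaded while evaluating the expression are at most `b` in absolute
value. -/
def Expr.LoadsLe (σ : Mem B) (b : ℕ) : Expr B → Prop
  | .const c => |c| ≤ b
  | .load x e => e.LoadsLe σ b ∧ |σ x (e.val σ)| ≤ b
  | .bin _ e₁ e₂ => e₁.LoadsLe σ b ∧ e₂.LoadsLe σ b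

/-- Each operation at most adds the bit lengths of its operands, plus one. Hence only constants and
loaded cells need an a priori bound; unreduced intermediate values inside an expression need none.
-/
theorem Expr.bitLen_val_le {σ : Mem B} {b : ℕ} {e : Expr B} (h : e.LoadsLe σ b) :
    bitLen (e.val σ) ≤ e.size * (Nat.size b + 1) := by
  induction e with
  | const c =>
    have := bitLen_le_size h
    simp only [Expr.val, Expr.size]; omega
  | load x e ih =>
    have := bitLen_le_size h.2
    simp only [Expr.val, Expr.size, add_mul]; omega
  | bin o e₁ e₂ ih₁ ih₂ =>
    have h1 := ih₁ h.1
    have h2 := ih₂ h.2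
    have := o.bitLen_val_le (e₁.val σ) (e₂.val σ)
    simp only [Expr.val, Expr.size, add_mul]; omega

theorem Op.cost_le (o : Op) (x y : ℤ) : o.cost x y ≤ (bitLen x + 1) * (bitLen y + 1) := by
  have : bitLen x + bitLen y + 1 ≤ (bitLen x + 1) * (bitLen y + 1) := by nlinarith
  cases o <;> simp only [Op.cost] <;> omega

/-- Multiplication and division are charged a product of bit lengths. The resulting cross term in
the sizes of the two subexpressions is absorbed by squaring the total size. -/
theorem Expr.cost_le {σ : Mem B} {b : ℕ} {e : Expr B} (h : e.LoadsLe σ b) :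
    e.cost σ ≤ e.size ^ 2 * (Nat.size b + 1) ^ 2 := by
  induction e with
  | const c =>
    have := bitLen_le_size h
    simp only [Expr.cost, Expr.size]; nlinarith
  | load x e ih =>
    have h1 := ih h.1
    have h2 := bitLen_le_size h.2
    have h3 := bitLen_val_le h.1
    simp only [Expr.cost, Expr.size]
    have : e.size * (Nat.size b + 1) ≤ e.size * (Nat.size b + 1) ^ 2 := by gcongr; nlinarith
    nlinarith
  | bin o e₁ e₂ ih₁ ih₂ =>
    have h1 := ih₁ h.1
    have h2 := ih₂ h.2
    have h3 := bitLen_val_le h.1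
    have h4 := bitLen_val_le h.2
    have h5 : o.cost (e₁.val σ) (e₂.val σ) ≤
        ((e₁.size + 1) * (Nat.size b + 1)) * ((e₂.size + 1) * (Nat.size b + 1)) :=
      (o.cost_le _ _).trans (Nat.mul_le_mul (by nlinarith) (by nlinarith))
    simp only [Expr.cost, Expr.size]
    have h6 : (e₁.size ^ 2 + e₂.size ^ 2 + (e₁.size + 1) * (e₂.size + 1)) * (Nat.size b + 1) ^ 2 ≤
        (e₁.size + e₂.size + 1) ^ 2 * (Nat.size b + 1) ^ 2 := by gcongr; nlinarith
    nlinarith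

/-! ### Renaming of banks -/

variable {B₁ : Type}

/-- Rename the banks of an expression. -/
def Expr.map (φ : B → B₁) : Expr B → Expr B₁
  | .const c => .const c
  | .load x e => .load (φ x) (e.map φ)
  | .bin o e₁ e₂ => .bin o (e₁.map φ) (e₂.map φ)

/-- Rename the banks of a program. -/
def Prog.map (φ : B → B₁) : Prog B → Prog B₁
  | .skip => .skip
  | .store x e v => .store (φ x) (e.map φ) (v.map φ)
  | .seq p₁ p₂ => .seq (p₁.map φ) (p₂.map φ)
  | .ite c p₁ p₂ => .ite (c.map φ) (p₁.map φ) (p₂.map φ)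
  | .loop c p => .loop (c.map φ) (p.map φ)

theorem Expr.val_map (φ : B → B₁) (σ : Mem B₁) (e : Expr B) :
    (e.map φ).val σ = e.val (σ ∘ φ) := by
  induction e with
  | const c => rfl
  | load x e ih => simp [Expr.map, Expr.val, ih]
  | bin o e₁ e₂ ih₁ ih₂ => simp [Expr.map, Expr.val, ih₁, ih₂]

theorem Expr.cost_map (φ : B → B₁) (σ : Mem B₁) (e : Expr B) :
    (e.map φ).cost σ = e.cost (σ ∘ φ) := by
  induction e with
  | const c => rfl
  | load x e ih => simp [Expr.map, Expr.cost, ih, Expr.val_map]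
  | bin o e₁ e₂ ih₁ ih₂ => simp [Expr.map, Expr.cost, ih₁, ih₂, Expr.val_map]

/-! ### Programs with a bound on the number of elementary instructions -/

/-- Bound on the cost of an elementary instruction whose expressions have fewer than `100` nodes and
only load numbers of absolute value at most `b`. -/
def unitCost (b : ℕ) : ℕ := 10000 * (Nat.size b + 1) ^ 2

/-- The additional `1` is the surcharge for testing the condition of a conditional or a loop. -/
theorem Expr.cost_succ_le_unitCost {σ : Mem B} {b : ℕ} {e : Expr B}
    (he : e.LoadsLe σ b) (hs : e.size < 100) :
    e.cost σ + 1 ≤ unitCost b := by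
  have h1 := Expr.cost_le he
  have h5 : (e.size + 1) ^ 2 * (Nat.size b + 1) ^ 2 ≤ 100 ^ 2 * (Nat.size b + 1) ^ 2 := by
    gcongr; omega
  have h6 : 1 ≤ (Nat.size b + 1) ^ 2 := Nat.one_le_pow _ _ (by omega)
  have h7 : (e.size + 1) ^ 2 * (Nat.size b + 1) ^ 2 = e.size ^ 2 * (Nat.size b + 1) ^ 2 +
    2 * e.size * (Nat.size b + 1) ^ 2 + (Nat.size b + 1) ^ 2 := by ring
  rw [unitCost]
  omega

/-- The memories agree outside the banks in the list. -/
def AgreeOff (X : List B) (σ τ : Mem B) : Prop := ∀ y, y ∉ X → τ y = σ y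

theorem AgreeOff.trans {X : List B} {σ τ ρ : Mem B} (h₁ : AgreeOff X σ τ) (h₂ : AgreeOff X τ ρ) :
    AgreeOff X σ ρ := fun y hy => (h₂ y hy).trans (h₁ y hy)

theorem AgreeOff.mono {X Y : List B} {σ τ : Mem B} (h : AgreeOff X σ τ) (hXY : X ⊆ Y) :
    AgreeOff Y σ τ := fun y hy => h y fun hX => hy (hXY hX)

variable [DecidableEq B]

/-- Started on `σ`, the program `p` halts after at most `s` elementary instructions, each of cost at
most `unitCost b`, in a memory that satisfies `P`. -/
def Runs (b : ℕ) (p : Prog B) (σ : Mem B) (s : ℕ) (P : Mem B → Prop) : Prop :=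
  ∃ τ t, Exec p σ τ t ∧ t ≤ s * unitCost b ∧ P τ

variable {b : ℕ} {σ : Mem B} {P Q : Mem B → Prop} {s s₁ s₂ : ℕ} {p p₁ p₂ : Prog B}

theorem Runs.mono (h : Runs b p σ s P) (hPQ : ∀ τ, P τ → Q τ) : Runs b p σ s Q := by
  obtain ⟨τ, t, h1, h2, h3⟩ := h
  exact ⟨τ, t, h1, h2, hPQ τ h3⟩

theorem Runs.mono_steps (h : Runs b p σ s₁ P) (hs : s₁ ≤ s₂) : Runs b p σ s₂ P := by
  obtain ⟨τ, t, h1, h2, h3⟩ := h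
  exact ⟨τ, t, h1, h2.trans (Nat.mul_le_mul_right _ hs), h3⟩

theorem Runs.seq (h₁ : Runs b p₁ σ s₁ P) (h₂ : ∀ τ, P τ → Runs b p₂ τ s₂ Q) :
    Runs b (.seq p₁ p₂) σ (s₁ + s₂) Q := by
  obtain ⟨τ, t, h1, h2, h3⟩ := h₁
  obtain ⟨ρ, u, h4, h5, h6⟩ := h₂ τ h3
  exact ⟨ρ, t + u, .seq h1 h4, by rw [add_mul]; omega, h6⟩

theorem Runs.store {x : B} {e v : Expr B} (he : e.LoadsLe σ b) (hv : v.LoadsLe σ b)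
    (hs : e.size + v.size < 100) (hP : P (σ.write x (e.val σ) (v.val σ))) :
    Runs b (.store x e v) σ 1 P := by
  refine ⟨_, _, .store σ x e v, ?_, hP⟩
  have h1 := Expr.cost_le he
  have h2 := Expr.cost_le hv
  have h3 := Expr.bitLen_val_le he
  have h4 := Expr.bitLen_val_le hv
  have h5 : (e.size + v.size + 1) ^ 2 * (Nat.size b + 1) ^ 2 ≤ 100 ^ 2 * (Nat.size b + 1) ^ 2 := by
    gcongr; omega
  have h6 : (e.size + v.size) * (Nat.size b + 1) ≤ (e.size + v.size) * (Nat.size b + 1) ^ 2 := by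
    gcongr; nlinarith
  have h7 : 0 ≤ 2 * e.size * v.size * (Nat.size b + 1) ^ 2 := by positivity
  rw [unitCost]
  nlinarith

theorem Runs.ite {c : Expr B} (hc : c.LoadsLe σ b) (hs : c.size < 100)
    (h₁ : c.val σ ≠ 0 → Runs b p₁ σ s P) (h₂ : c.val σ = 0 → Runs b p₂ σ s P) :
    Runs b (.ite c p₁ p₂) σ (s + 1) P := by
  have hcost := Expr.cost_succ_le_unitCost hc hs
  by_cases h : c.val σ = 0
  · obtain ⟨τ, t, h3, h4, h5⟩ := h₂ h
    exact ⟨τ, _, .ite_false h h3, by rw [add_mul]; omega, h5⟩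
  · obtain ⟨τ, t, h3, h4, h5⟩ := h₁ h
    exact ⟨τ, _, .ite_true h h3, by rw [add_mul]; omega, h5⟩

theorem Mem.write_self (σ : Mem B) (x : B) (a v : ℤ) : σ.write x a v x a = v := by
  simp [Mem.write]

theorem Mem.write_bank (σ : Mem B) (x : B) (a v : ℤ) :
    σ.write x a v x = Function.update (σ x) a v := by
  simp [Mem.write]

theorem Mem.write_ne (σ : Mem B) {x y : B} (a v : ℤ) (h : y ≠ x) : σ.write x a v y = σ y := by
  simp [Mem.write, h]

theorem agreeOff_write (σ : Mem B) (x : B) (a v : ℤ) : AgreeOff [x] σ (σ.write x a v) :=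
  fun y hy => Mem.write_ne σ a v (by simpa using hy)

/-- The scalar variable kept in cell `0` of the bank `x`. -/
abbrev Expr.var (x : B) : Expr B := .load x (.const 0)

/-- For `x` from `0` to `m - 1` do `p`. -/
def Prog.for (x : B) (m : Expr B) (p : Prog B) : Prog B :=
  .seq (.store x (.const 0) (.const 0))
    (.loop (.bin .lt (.var x) m) (.seq p (.store x (.const 0) (.bin .add (.var x) (.const 1)))))

/-- `I i` describes the memory at the start of round `i`, counter included; the body is to establish
`I (i + 1)` as seen after the increment. Each round pays for the test, the body and the increment,
and the final `2` is the initialisation and the failing test. The bound `m` is re-evaluated every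
round, so its value must follow from the invariant. -/
theorem Runs.for {x : B} {m : Expr B} (M : ℕ) (I : ℕ → Mem B → Prop) (hMb : M < b)
    (hsize : m.size < 50)
    (hzero : I 0 (σ.write x 0 0))
    (hm : ∀ i ≤ M, ∀ τ, I i τ → τ x 0 = i ∧ m.val τ = M ∧ m.LoadsLe τ b)
    (hbody : ∀ i < M, ∀ τ, I i τ →
      Runs b p τ s fun ρ => ρ x 0 = i ∧ I (i + 1) (ρ.write x 0 (i + 1))) :
    Runs b (.for x m p) σ (M * (s + 2) + 2) (I M) := by
  -- The increment loads the constant `1`; the strict inequality `M < b` makes it fit even when `M =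
  -- 0`.
  have hb : (1 : ℤ) ≤ b := by omega
  -- Induction on the number `d` of remaining rounds.
  have key : ∀ d i, i + d = M → ∀ τ, I i τ → Runs b
      (.loop (.bin .lt (.var x) m) (.seq p (.store x (.const 0) (.bin .add (.var x) (.const 1)))))
      τ (d * (s + 2) + 1) (I M) := by
    intro d
    induction d with
    | zero =>
      intro i hi τ hτ
      obtain rfl : i = M := hi
      obtain ⟨h1, h2, h3⟩ := hm i le_rfl τ hτ
      have hl : (Expr.bin .lt (.var x) m).LoadsLe τ b := by
        refine ⟨⟨?_, ?_⟩, h3⟩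
        · simp [Expr.LoadsLe]
        · simp only [Expr.val, h1]; rw [abs_of_nonneg (by omega)]; omega
      refine ⟨τ, _, .loop_done ?_, ?_, hτ⟩
      · simp [Expr.val, Op.val, h1, h2]
      · have := Expr.cost_succ_le_unitCost hl (by simp only [Expr.size]; omega)
        simpa using this
    | succ d ih =>
      intro i hi τ hτ
      obtain ⟨h1, h2, h3⟩ := hm i (by omega) τ hτ
      have hl : (Expr.bin .lt (.var x) m).LoadsLe τ b := by
        refine ⟨⟨?_, ?_⟩, h3⟩
        · simp [Expr.LoadsLe]
        · simp only [Expr.val, h1]; rw [abs_of_nonneg (by omega)]; omega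
      have hcost := Expr.cost_succ_le_unitCost hl (by simp only [Expr.size]; omega)
      obtain ⟨ρ, t, h4, h5, h6⟩ := (Runs.seq (hbody i (by omega) τ hτ)
        (s₂ := 1) (Q := I (i + 1)) (p₂ := .store x (.const 0) (.bin .add (.var x) (.const 1)))
        (fun ρ hρ => Runs.store (by simp [Expr.LoadsLe])
          ⟨⟨by simp [Expr.LoadsLe], by
            simp only [Expr.val, hρ.1]; rw [abs_of_nonneg (by omega)]; omega⟩,
            by simpa [Expr.LoadsLe] using hb⟩ (by simp [Expr.size])
          (by simpa [Expr.val, Op.val, hρ.1] using hρ.2)))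
      obtain ⟨ρ', t', h8, h9, h10⟩ := ih (i + 1) (by omega) ρ h6
      refine ⟨ρ', _, .loop_step ?_ h4 h8, ?_, h10⟩
      · simp only [Expr.val, Op.val, h1, h2]
        rw [if_pos (by omega)]; simp
      · nlinarith
  have h := Runs.seq (b := b) (σ := σ) (p₁ := .store x (.const 0) (.const 0))
    (P := fun τ => I 0 τ) (s₁ := 1) (Runs.store (by simp [Expr.LoadsLe]) (by simp [Expr.LoadsLe])
      (by simp [Expr.size]) (by simpa [Expr.val] using hzero))
    (key M 0 (by omega))
  exact h.mono_steps (by omega)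

/-- A loop whose `i`-th round overwrites cell `i` of the bank `y` by `f i`, and changes nothing else
but its working banks `X`. -/
theorem Runs.fill {x y : B} {m : Expr B} (M : ℕ) (f : ℕ → ℤ) (X : List B) (hMb : M < b)
    (hsize : m.size < 50) (hxX : x ∉ y :: X)
    (hm : ∀ τ, AgreeOff (x :: y :: X) σ τ → m.val τ = M ∧ m.LoadsLe τ b)
    (hbody : ∀ i < M, ∀ τ, τ x 0 = (i : ℤ) → AgreeOff (x :: y :: X) σ τ →
      (∀ j < i, τ y (j : ℕ) = f j) → τ y (i : ℤ) = σ y (i : ℤ) →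
      Runs b p τ s fun ρ => AgreeOff (y :: X) τ ρ ∧ ρ y = Function.update (τ y) (i : ℤ) (f i)) :
    Runs b (.for x m p) σ (M * (s + 2) + 2)
      fun ρ => AgreeOff (x :: y :: X) σ ρ ∧ ∀ i < M, ρ y (i : ℕ) = f i := by
  have hxy : y ≠ x := by rintro rfl; simp at hxX
  -- Besides the finished cells below `i`, the invariant records that cells from `i` on are still
  -- the original ones, which in-place updates such as `accumProg` rely on.
  refine (Runs.for M (fun i τ => τ x 0 = (i : ℤ) ∧ AgreeOff (x :: y :: X) σ τ ∧
      (∀ j < i, τ y (j : ℕ) = f j) ∧ ∀ j : ℕ, i ≤ j → τ y (j : ℤ) = σ y (j : ℤ)) hMb hsize ?_ ?_ ?_).mono ?_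
  · refine ⟨by simp [Mem.write_self], (agreeOff_write σ x 0 0).mono (by simp), by simp, ?_⟩
    intro j _
    rw [Mem.write_ne _ _ _ hxy]
  · rintro i - τ ⟨h1, h2, -, -⟩
    exact ⟨h1, hm τ h2⟩
  · rintro i hi τ ⟨h1, h2, h3, h4⟩
    refine (hbody i hi τ h1 h2 h3 (h4 i le_rfl)).mono ?_
    rintro ρ ⟨h5, h6⟩
    refine ⟨by rw [h5 x hxX, h1], by simp [Mem.write_self], ?_, ?_, ?_⟩
    · exact (h2.trans (h5.mono (by simp))).trans ((agreeOff_write ρ x 0 _).mono (by simp))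
    · intro j hj
      rw [Mem.write_ne _ _ _ hxy, h6]
      rcases Nat.lt_succ_iff_lt_or_eq.1 hj with hj | rfl
      · rw [Function.update_of_ne (by exact_mod_cast hj.ne), h3 j hj]
      · simp
    · intro j hj
      rw [Mem.write_ne _ _ _ hxy, h6, Function.update_of_ne (by omega), h4 j (by omega)]
  · rintro ρ ⟨-, h1, h2, -⟩
    exact ⟨h1, h2⟩

variable [DecidableEq B₁]

/-- A run of `p` can be carried out, at the same cost, in the banks of a larger memory. -/
theorem Exec.map {φ : B → B₁} (hφ : Function.Injective φ) {σ τ : Mem B} {t : ℕ}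
    (h : Exec p σ τ t) (σ' : Mem B₁) (hσ : σ' ∘ φ = σ) :
    ∃ τ', Exec (p.map φ) σ' τ' t ∧ τ' ∘ φ = τ ∧ ∀ y, y ∉ Set.range φ → τ' y = σ' y := by
  induction h generalizing σ' with
  | skip σ => exact ⟨σ', .skip _, hσ, fun _ _ => rfl⟩
  | store σ x e v =>
    subst hσ
    refine ⟨σ'.write (φ x) ((e.map φ).val σ') ((v.map φ).val σ'), ?_, ?_, ?_⟩
    · simpa [Prog.map, Expr.val_map, Expr.cost_map] using Exec.store σ' (φ x) (e.map φ) (v.map φ)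
    · funext y
      by_cases hy : y = x
      · subst hy
        simp [Mem.write_bank, Expr.val_map]
      · simp [Mem.write_ne _ _ _ hy, Mem.write_ne _ _ _ (hφ.ne hy)]
    · intro y hy
      exact Mem.write_ne _ _ _ (by rintro rfl; exact hy ⟨x, rfl⟩)
  | seq _ _ ih₁ ih₂ =>
    obtain ⟨τ', h1, h2, h3⟩ := ih₁ σ' hσ
    obtain ⟨ρ', h4, h5, h6⟩ := ih₂ τ' h2
    exact ⟨ρ', .seq h1 h4, h5, fun y hy => (h6 y hy).trans (h3 y hy)⟩
  | @ite_true c _ _ _ _ _ hc _ ih =>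
    obtain ⟨τ', h1, h2, h3⟩ := ih σ' hσ
    subst hσ
    refine ⟨τ', ?_, h2, h3⟩
    rw [← Expr.cost_map]
    exact .ite_true (by rwa [Expr.val_map]) h1
  | @ite_false c _ _ _ _ _ hc _ ih =>
    obtain ⟨τ', h1, h2, h3⟩ := ih σ' hσ
    subst hσ
    refine ⟨τ', ?_, h2, h3⟩
    rw [← Expr.cost_map]
    exact .ite_false (by rwa [Expr.val_map]) h1
  | loop_done hc =>
    subst hσ
    refine ⟨σ', ?_, rfl, fun _ _ => rfl⟩
    rw [← Expr.cost_map]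
    exact .loop_done (by rwa [Expr.val_map])
  | loop_step hc _ _ ih₁ ih₂ =>
    obtain ⟨τ', h1, h2, h3⟩ := ih₁ σ' hσ
    obtain ⟨ρ', h4, h5, h6⟩ := ih₂ τ' h2
    subst hσ
    refine ⟨ρ', ?_, h5, fun y hy => (h6 y hy).trans (h3 y hy)⟩
    rw [← Expr.cost_map]
    exact .loop_step (by rwa [Expr.val_map]) h1 h4

end Framework

/-! ### Matrices stored row by row -/

section Flat

variable {q g h : ℕ}

theorem div_lt_of_lt_cells {p : ℕ} (hp : p < (g + 1) * h) : p / h < g + 1 :=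
  Nat.div_lt_of_lt_mul (by rwa [mul_comm])

theorem mod_lt_of_lt_cells {p : ℕ} (hp : p < (g + 1) * h) : p % h < h :=
  Nat.mod_lt _ (Nat.pos_of_ne_zero fun h0 => by simp [h0] at hp)

/-- The `p`-th entry of a matrix stored row by row, as an integer in `{0, …, q - 1}`. -/
def flat (X : Ct q g h) (p : ℕ) : ℤ :=
  if hp : p < (g + 1) * h then
    (X ⟨p / h, div_lt_of_lt_cells hp⟩ ⟨p % h, mod_lt_of_lt_cells hp⟩).val
  else 0

theorem flat_of_lt (X : Ct q g h) {p : ℕ} (hp : p < (g + 1) * h) :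
    flat X p = (X ⟨p / h, div_lt_of_lt_cells hp⟩ ⟨p % h, mod_lt_of_lt_cells hp⟩).val :=
  dif_pos hp

theorem index_lt {a c : ℕ} (ha : a < g + 1) (hc : c < h) : a * h + c < (g + 1) * h := by
  nlinarith

theorem flat_index (X : Ct q g h) {a c : ℕ} (ha : a < g + 1) (hc : c < h) :
    flat X (a * h + c) = (X ⟨a, ha⟩ ⟨c, hc⟩).val := by
  have h1 : (a * h + c) / h = a := by
    rw [mul_comm, Nat.mul_add_div (by omega), Nat.div_eq_of_lt hc, add_zero]
  have h2 : (a * h + c) % h = c := by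
    rw [mul_comm, Nat.mul_add_mod, Nat.mod_eq_of_lt hc]
  rw [flat_of_lt X (index_lt ha hc)]
  simp only [h1, h2]

theorem flat_nonneg (X : Ct q g h) (p : ℕ) : 0 ≤ flat X p := by
  unfold flat; split_ifs <;> positivity

theorem abs_flat_lt [NeZero q] (X : Ct q g h) (p : ℕ) : |flat X p| < q := by
  rw [abs_of_nonneg (flat_nonneg X p)]
  unfold flat
  split_ifs
  · exact_mod_cast ZMod.val_lt _
  · exact_mod_cast Nat.pos_of_neZero q

/-- An integer congruent to an entry gives the stored value on reduction modulo `q`. -/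
theorem emod_eq_flat [NeZero q] {X : Ct q g h} {p : ℕ} (hp : p < (g + 1) * h) {z : ℤ}
    (hz : (z : ZMod q) = X ⟨p / h, div_lt_of_lt_cells hp⟩ ⟨p % h, mod_lt_of_lt_cells hp⟩) :
    z % q = flat X p := by
  rw [flat_of_lt X hp, ← hz, ZMod.val_intCast]

theorem intCast_flat [NeZero q] (X : Ct q g h) {p : ℕ} (hp : p < (g + 1) * h) :
    (flat X p : ZMod q) = X ⟨p / h, div_lt_of_lt_cells hp⟩ ⟨p % h, mod_lt_of_lt_cells hp⟩ := by
  rw [flat_of_lt X hp]; simp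

/-- The first cells of `c` hold the matrix `X`. -/
def IsFlat (c : ℤ → ℤ) (X : Ct q g h) : Prop := ∀ p < (g + 1) * h, c (p : ℕ) = flat X p

theorem isFlat_iff {c : ℤ → ℤ} {X : Ct q g h} :
    IsFlat c X ↔ ∀ (a : Fin (g + 1)) (j : Fin h), c ((a * h + j : ℕ) : ℤ) = (X a j).val := by
  constructor
  · intro H a j
    rw [H _ (index_lt a.2 j.2), flat_index X a.2 j.2]
  · intro H p hp
    rw [flat_of_lt X hp, ← H]
    simp only [Nat.div_add_mod']

/-- Entries are stored as canonical representatives, so equality modulo `q` can be decided cell by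
cell. -/
theorem IsFlat.inj {c d : ℤ → ℤ} [NeZero q] {X Y : Ct q g h} (hX : IsFlat c X) (hY : IsFlat d Y) :
    (∀ p < (g + 1) * h, c (p : ℕ) = d (p : ℕ)) ↔ X = Y := by
  rw [isFlat_iff] at hX hY
  constructor
  · intro H
    ext a j
    have := H (a * h + j) (index_lt a.2 j.2)
    rw [hX, hY] at this
    exact ZMod.val_injective q (by exact_mod_cast this)
  · rintro rfl
    intro p hp
    rw [isFlat_iff.2 hX p hp, isFlat_iff.2 hY p hp]

/-- The machine has no bit operations; a bit is obtained by dividing by a power of two and reducing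
modulo `2`. -/
theorem intCast_ediv_two_pow_emod_two (v t : ℕ) :
    ((((v : ℤ) / 2 ^ t % 2 : ℤ)) : ZMod q) = if v.testBit t then 1 else 0 := by
  have : ((v : ℤ) / 2 ^ t % 2) = ((v / 2 ^ t % 2 : ℕ) : ℤ) := by push_cast; rfl
  rw [this, Nat.testBit_eq_decide_div_mod_eq]
  rcases Nat.mod_two_eq_zero_or_one (v / 2 ^ t) with h | h <;> simp [h]

/-- Division and remainder by `L = 0` do not describe a position in the gadget matrix. This isolates
the degenerate case, in which `ZMod q` is trivial. -/
theorem eq_one_of_clog_eq_zero [NeZero q] (h0 : Nat.clog 2 q = 0) : q = 1 := by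
  have h1 := NeZero.ne q
  by_contra h2
  have := Nat.clog_pos (b := 2) (n := q) (by norm_num) (by omega)
  omega

/-- The rows of the bit decomposition from `(g + 1) * L` on vanish, with `L = Nat.clog 2 q`, so the
inner product stops there. The left side is what `productProg` computes: bits are extracted when
needed and the decomposition is never stored. -/
theorem flat_mul_gadgetInv [NeZero q] (hh : (g + 1) * Nat.clog 2 q ≤ h) (X Y : Ct q g h) {p : ℕ}
    (hp : p < (g + 1) * h) :
    (∑ j ∈ Finset.range ((g + 1) * Nat.clog 2 q),
      flat Y (p / h * h + j) *
        (flat X (j / Nat.clog 2 q * h + p % h) / 2 ^ (j % Nat.clog 2 q) % 2)) % q =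
      flat (Y * gadgetInv X) p := by
  have ha := div_lt_of_lt_cells hp
  have hc := mod_lt_of_lt_cells hp
  apply emod_eq_flat hp
  push_cast
  rw [Matrix.mul_apply]
  set F : ℕ → ZMod q := fun j => if hj : j < h then
    Y ⟨p / h, ha⟩ ⟨j, hj⟩ * gadgetInv X ⟨j, hj⟩ ⟨p % h, hc⟩ else 0 with hF
  have h1 : ∑ j : Fin h, Y ⟨p / h, ha⟩ j * gadgetInv X j ⟨p % h, hc⟩ =
      ∑ j ∈ Finset.range h, F j := by
    rw [Finset.sum_range]
    exact Finset.sum_congr rfl fun j _ => by simp [hF]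
  rw [h1]
  have h2 : ∑ j ∈ Finset.range h, F j = ∑ j ∈ Finset.range ((g + 1) * Nat.clog 2 q), F j := by
    symm
    apply Finset.sum_subset (by simpa using hh)
    intro j hj hj'
    simp only [Finset.mem_range, not_lt] at hj hj'
    -- For `L = 0` the quotient `j / 0 = 0` passes the row test of `gadgetInv`, so the vanishing has
    -- to come from the triviality of `ZMod 1`.
    rcases Nat.eq_zero_or_pos (Nat.clog 2 q) with h0 | h0
    · have : q = 1 := eq_one_of_clog_eq_zero h0
      subst this
      exact Subsingleton.elim _ _
    · simp only [hF, gadgetInv, hj, dif_pos]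
      rw [dif_neg, mul_zero]
      rw [not_lt, Nat.le_div_iff_mul_le h0]
      exact hj'
  rw [h2]
  refine Finset.sum_congr rfl fun j hj => ?_
  rw [Finset.mem_range] at hj
  have hjh : j < h := by omega
  have hjL : j / Nat.clog 2 q < g + 1 := Nat.div_lt_of_lt_mul (by rwa [mul_comm])
  simp only [hF, hjh, dif_pos, gadgetInv, hjL]
  rw [flat_index Y ha hjh, flat_index X hjL hc]
  have := intCast_ediv_two_pow_emod_two (q := q) (X ⟨j / Nat.clog 2 q, hjL⟩ ⟨p % h, hc⟩).val
    (j % Nat.clog 2 q)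
  rw [← this]
  push_cast
  simp

theorem two_pow_mod_clog_lt {j : ℕ} (hq : 0 < Nat.clog 2 q) : 2 ^ (j % Nat.clog 2 q) < q := by
  rw [← Nat.lt_clog_iff_pow_lt (by norm_num)]
  exact Nat.mod_lt _ hq

/-- For `L > 0` the second condition follows from the first. For `q = 1` it fails, which gives the
only possible entry `0`. No reduction is needed, since the powers involved are smaller than `q`. -/
theorem flat_gadget [NeZero q] {p : ℕ} (hp : p < (g + 1) * h) :
    flat (gadget q g h) p =
      if p % h / Nat.clog 2 q = p / h ∧ p % h < (g + 1) * Nat.clog 2 q then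
        2 ^ (p % h % Nat.clog 2 q) else 0 := by
  have ha := div_lt_of_lt_cells hp
  rw [flat_of_lt _ hp, gadget]
  rcases Nat.eq_zero_or_pos (Nat.clog 2 q) with h0 | h0
  · have : q = 1 := eq_one_of_clog_eq_zero h0
    subst this
    rw [Subsingleton.elim (ite _ _ _ : ZMod 1) 0]
    simp
  · by_cases h1 : p % h / Nat.clog 2 q = p / h
    · have h2 : p % h < (g + 1) * Nat.clog 2 q := by
        rw [← Nat.div_lt_iff_lt_mul h0]; omega
      rw [if_pos h1, if_pos ⟨h1, h2⟩]
      have := two_pow_mod_clog_lt (j := p % h) h0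
      rw [← Nat.cast_two, ← Nat.cast_pow, ZMod.val_natCast, Nat.mod_eq_of_lt this]
      push_cast; rfl
    · simp [h1]

end Flat

/-! ### The program for homomorphic evaluation -/

section EvalProgram

instance : Add (Expr Bank) := ⟨.bin .add⟩
instance : Sub (Expr Bank) := ⟨.bin .sub⟩
instance : Mul (Expr Bank) := ⟨.bin .mul⟩
instance : Div (Expr Bank) := ⟨.bin .div⟩
instance : Mod (Expr Bank) := ⟨.bin .mod⟩

variable (σ : Mem Bank) (b : ℕ) (e e' : Expr Bank)

@[simp] theorem Expr.val_const (c : ℤ) : (Expr.const c : Expr Bank).val σ = c := rfl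
@[simp] theorem Expr.val_load (x : Bank) : (Expr.load x e).val σ = σ x (e.val σ) := rfl
@[simp] theorem Expr.val_add : (e + e').val σ = e.val σ + e'.val σ := rfl
@[simp] theorem Expr.val_sub : (e - e').val σ = e.val σ - e'.val σ := rfl
@[simp] theorem Expr.val_mul : (e * e').val σ = e.val σ * e'.val σ := rfl
@[simp] theorem Expr.val_div : (e / e').val σ = e.val σ / e'.val σ := rfl
@[simp] theorem Expr.val_mod : (e % e').val σ = e.val σ % e'.val σ := rfl
@[simp] theorem Expr.val_eq : (Expr.bin .eq e e').val σ = if e.val σ = e'.val σ then 1 else 0 := rfl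
@[simp] theorem Expr.val_lt : (Expr.bin .lt e e').val σ = if e.val σ < e'.val σ then 1 else 0 := rfl

@[simp] theorem Expr.loadsLe_const (c : ℤ) : (Expr.const c).LoadsLe σ b ↔ |c| ≤ b := Iff.rfl
@[simp] theorem Expr.loadsLe_load (x : Bank) :
    (Expr.load x e).LoadsLe σ b ↔ e.LoadsLe σ b ∧ |σ x (e.val σ)| ≤ b := Iff.rfl
@[simp] theorem Expr.loadsLe_bin (o : Op) :
    (Expr.bin o e e').LoadsLe σ b ↔ e.LoadsLe σ b ∧ e'.LoadsLe σ b := Iff.rfl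
@[simp] theorem Expr.loadsLe_add : (e + e').LoadsLe σ b ↔ e.LoadsLe σ b ∧ e'.LoadsLe σ b := Iff.rfl
@[simp] theorem Expr.loadsLe_sub : (e - e').LoadsLe σ b ↔ e.LoadsLe σ b ∧ e'.LoadsLe σ b := Iff.rfl
@[simp] theorem Expr.loadsLe_mul : (e * e').LoadsLe σ b ↔ e.LoadsLe σ b ∧ e'.LoadsLe σ b := Iff.rfl
@[simp] theorem Expr.loadsLe_div : (e / e').LoadsLe σ b ↔ e.LoadsLe σ b ∧ e'.LoadsLe σ b := Iff.rfl
@[simp] theorem Expr.loadsLe_mod : (e % e').LoadsLe σ b ↔ e.LoadsLe σ b ∧ e'.LoadsLe σ b := Iff.rfl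

/-- Powers of two. -/
abbrev bPow : Bank := .work 0
/-- The gadget matrix. -/
abbrev bGad : Bank := .work 1
/-- The value of the subcircuit evaluated so far. -/
abbrev bRes : Bank := .work 2
/-- The value of the next literal. -/
abbrev bLit : Bank := .work 3
/-- The product of the literal and the bit decomposition. -/
abbrev bProd : Bank := .work 4
abbrev bCell : Bank := .work 5
abbrev bCol : Bank := .work 6
abbrev bAcc : Bank := .work 7
/-- The coordinate whose circuit is evaluated. -/
abbrev bCoord : Bank := .work 8
abbrev bRound : Bank := .work 9

abbrev ePar (i : ℤ) : Expr Bank := .load .param (.const i)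
abbrev eNum (c : ℤ) : Expr Bank := .const c
abbrev eVar (x : Bank) : Expr Bank := .load x (.const 0)

abbrev eQ : Expr Bank := ePar 2
abbrev eH : Expr Bank := ePar 4
abbrev eLogN : Expr Bank := ePar 5
abbrev eLogQ : Expr Bank := ePar 6
/-- The number of entries of a ciphertext. -/
abbrev eCells : Expr Bank := (ePar 3 + eNum 1) * eH
/-- The number of non-zero columns of the gadget matrix. -/
abbrev eCols : Expr Bank := (ePar 3 + eNum 1) * eLogQ
/-- The input bit processed in the current round; the circuit is evaluated from the last one on. -/
abbrev eBit : Expr Bank := eLogN - eNum 1 - eVar bRound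

/-- One table serves two purposes: powers below `2 ^ L` for the gadget matrix and the bit
decomposition, and powers below `2 ^ ⌈log₂ n⌉` for reading the digits of a coordinate. -/
def powProg : Prog Bank :=
  .for bCell (eLogQ + eLogN)
    (.ite (.bin .eq (eVar bCell) (eNum 0))
      (.store bPow (eVar bCell) (eNum 1))
      (.store bPow (eVar bCell) (eNum 2 * .load bPow (eVar bCell - eNum 1))))

def gadgetProg : Prog Bank :=
  .for bCell eCells
    (.ite (.bin .eq (eVar bCell % eH / eLogQ) (eVar bCell / eH) *
        .bin .lt (eVar bCell % eH) eCols)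
      (.store bGad (eVar bCell) (.load bPow (eVar bCell % eH % eLogQ)))
      (.store bGad (eVar bCell) (eNum 0)))

def copyProg (dst src : Bank) : Prog Bank :=
  .for bCell eCells (.store dst (eVar bCell) (.load src (eVar bCell)))

def literalProg : Prog Bank :=
  .for bCell eCells
    (.ite (eVar bCoord / .load bPow eBit % eNum 2)
      (.store bLit (eVar bCell) (.load .ct (eBit * eCells + eVar bCell)))
      (.store bLit (eVar bCell)
        ((.load bGad (eVar bCell) - .load .ct (eBit * eCells + eVar bCell)) % eQ)))

/-- The accumulator is reduced modulo `q` after every term so that it stays below `b`. The product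
goes to a separate bank because whole columns of `bRes` are still being read. -/
def productProg : Prog Bank :=
  .for bCell eCells
    (.seq (.store bAcc (eNum 0) (eNum 0))
      (.seq
        (.for bCol eCols
          (.store bAcc (eNum 0)
            ((eVar bAcc + .load bLit (eVar bCell / eH * eH + eVar bCol) *
              (.load bRes (eVar bCol / eLogQ * eH + eVar bCell % eH) /
                .load bPow (eVar bCol % eLogQ) % eNum 2)) % eQ)))
        (.store bProd (eVar bCell) (eVar bAcc))))

/-- Evaluation of the circuit of the coordinate in `bCoord`; the result is left in `bRes`. -/
def evalProg : Prog Bank :=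
  .seq powProg (.seq gadgetProg (.seq (copyProg bRes bGad)
    (.for bRound eLogN (.seq literalProg (.seq productProg (copyProg bRes bProd))))))

/-- The numbers handled by the programs are at most `b`. -/
structure Fits (b k n q g h : ℕ) : Prop where
  cols_le : (g + 1) * Nat.clog 2 q ≤ h
  lt : n + k + q + g + h + (g + 1) * h + 2 ^ (Nat.clog 2 q + Nat.clog 2 n) + 10 < b

/-- The memory holds the parameters and the ciphertexts. -/
structure HoldsCt (k : ℕ) {n q g h : ℕ} (ct : Fin (Nat.clog 2 n) → Ct q g h) (σ : Mem Bank) :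
    Prop where
  sparsity : σ .param 1 = k
  modulus : σ .param 2 = q
  latticeDim : σ .param 3 = g
  columns : σ .param 4 = h
  log_dim : σ .param 5 = Nat.clog 2 n
  log_modulus : σ .param 6 = Nat.clog 2 q
  ct : ∀ (j : Fin (Nat.clog 2 n)), ∀ p < (g + 1) * h,
    σ .ct ((j * ((g + 1) * h) + p : ℕ) : ℤ) = flat (ct j) p

variable {σ b} {k n q g h : ℕ} {ct : Fin (Nat.clog 2 n) → Ct q g h}

/-- Frame rule: the subroutines write only to banks other than `param` and `ct`. The side conditions
on concrete bank lists are discharged by `decide`. -/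
theorem HoldsCt.congr {τ : Mem Bank} {X : List Bank} (H : HoldsCt k ct σ) (hτ : AgreeOff X σ τ)
    (hX₁ : Bank.param ∉ X := by decide) (hX₂ : Bank.ct ∉ X := by decide) : HoldsCt k ct τ := by
  have h1 := hτ _ hX₁
  have h2 := hτ _ hX₂
  exact ⟨h1 ▸ H.sparsity, h1 ▸ H.modulus, h1 ▸ H.latticeDim, h1 ▸ H.columns, h1 ▸ H.log_dim,
    h1 ▸ H.log_modulus, h2 ▸ H.ct⟩

theorem Fits.bounds (F : Fits b k n q g h) : n ≤ b ∧ k < b ∧ q ≤ b ∧ g ≤ b ∧ h ≤ b ∧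
    (g + 1) * h < b ∧ (g + 1) * Nat.clog 2 q < b ∧ Nat.clog 2 q + Nat.clog 2 n < b ∧
    Nat.clog 2 q ≤ b ∧ Nat.clog 2 n < b ∧ 2 ^ (Nat.clog 2 q + Nat.clog 2 n) ≤ b ∧ 10 ≤ b := by
  obtain ⟨h1, h2⟩ := F
  have h3 := Nat.lt_two_pow_self (n := Nat.clog 2 q + Nat.clog 2 n)
  refine ⟨?_, ?_, ?_, ?_, ?_, ?_, ?_, ?_, ?_, ?_, ?_, ?_⟩ <;> omega

theorem Fits.two_pow_le (F : Fits b k n q g h) {t : ℕ} (ht : t ≤ Nat.clog 2 q + Nat.clog 2 n) :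
    |(2 : ℤ) ^ t| ≤ b := by
  have h1 := F.bounds.2.2.2.2.2.2.2.2.2.2.1
  rw [abs_of_nonneg (by positivity)]
  exact_mod_cast (Nat.pow_le_pow_right (by norm_num) ht).trans h1

theorem HoldsCt.cells (F : Fits b k n q g h) (H : HoldsCt k ct σ) :
    eCells.val σ = ((g + 1) * h : ℕ) ∧ eCells.LoadsLe σ b := by
  have := F.bounds
  refine ⟨by simp [H.latticeDim, H.columns], ?_⟩
  simp [H.latticeDim, H.columns]
  omega

theorem HoldsCt.cols (F : Fits b k n q g h) (H : HoldsCt k ct σ) :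
    eCols.val σ = ((g + 1) * Nat.clog 2 q : ℕ) ∧ eCols.LoadsLe σ b := by
  have := F.bounds
  refine ⟨by simp [H.latticeDim, H.log_modulus], ?_⟩
  simp [H.latticeDim, H.log_modulus]
  omega

/-! ### Correctness and instruction counts of the evaluation routines -/

theorem runs_powProg (F : Fits b k n q g h) (H : HoldsCt k ct σ) :
    Runs b powProg σ ((Nat.clog 2 q + Nat.clog 2 n) * 4 + 2) fun ρ =>
      AgreeOff [bCell, bPow] σ ρ ∧
        ∀ t < Nat.clog 2 q + Nat.clog 2 n, ρ bPow (t : ℕ) = 2 ^ t := by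
  have hb := F.bounds
  refine Runs.fill (X := []) (s := 2) _ (fun t => 2 ^ t) (by omega) (by decide) (by decide) ?_ ?_
  · intro τ hτ
    have Hτ := H.congr hτ
    refine ⟨by simp [Hτ.log_dim, Hτ.log_modulus], ?_⟩
    simp [Hτ.log_dim, Hτ.log_modulus]
    omega
  · intro i hi τ hi0 hτ hprev _
    refine Runs.ite ?_ (by decide) (fun hc => ?_) (fun hc => ?_)
    · simp [hi0]; omega
    · have : i = 0 := by
        by_contra h0
        simp [hi0, h0] at hc
      subst this
      refine Runs.store ?_ ?_ (by decide) ⟨agreeOff_write _ _ _ _, ?_⟩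
      · simp [hi0]
      · simp; omega
      · simp [Mem.write_bank, hi0]
    · have h0 : i ≠ 0 := by
        rintro rfl
        simp [hi0] at hc
      obtain ⟨j, rfl⟩ := Nat.exists_eq_succ_of_ne_zero h0
      have hj := hprev j (by omega)
      have hpow := F.two_pow_le (t := j) (by omega)
      refine Runs.store ?_ ?_ (by decide) ⟨agreeOff_write _ _ _ _, ?_⟩
      · simp [hi0, abs_le]; omega
      · simp [hi0, hj, abs_le] at hpow ⊢; omega
      · simp [Mem.write_bank, hi0, hj, pow_succ, mul_comm]

theorem runs_gadgetProg [NeZero q] (F : Fits b k n q g h) (H : HoldsCt k ct σ)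
    (hpow : ∀ t < Nat.clog 2 q + Nat.clog 2 n, σ bPow (t : ℕ) = 2 ^ t) :
    Runs b gadgetProg σ ((g + 1) * h * 4 + 2) fun ρ =>
      AgreeOff [bCell, bGad] σ ρ ∧ IsFlat (ρ bGad) (gadget q g h) := by
  have hb := F.bounds
  refine Runs.fill (X := []) (s := 2) _ _ (by omega) (by decide) (by decide)
    (fun τ hτ => (H.congr hτ).cells F) ?_
  intro i hi τ hi0 hτ _ _
  have Hτ := H.congr hτ
  have hpow' : τ bPow = σ bPow := hτ _ (by decide)
  have hcond : (Expr.bin .eq (eVar bCell % eH / eLogQ) (eVar bCell / eH) *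
        .bin .lt (eVar bCell % eH) eCols).val τ =
      if i % h / Nat.clog 2 q = i / h ∧ i % h < (g + 1) * Nat.clog 2 q then 1 else 0 := by
    simp only [Expr.val_mul, Expr.val_eq, Expr.val_lt, (Hτ.cols F).1]
    simp only [Expr.val_div, Expr.val_mod, Expr.val_load, Expr.val_const, hi0, Hτ.columns,
      Hτ.log_modulus]
    norm_cast
    split_ifs <;> simp_all
  refine Runs.ite ?_ (by decide) (fun hc => ?_) (fun hc => ?_)
  · simp [hi0, Hτ.columns, Hτ.log_modulus, Hτ.latticeDim]; omega
  · rw [hcond] at hc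
    have hc' : i % h / Nat.clog 2 q = i / h ∧ i % h < (g + 1) * Nat.clog 2 q := by
      by_contra h0
      simp [h0] at hc
    -- A true condition excludes `L = 0`, so the index into the table of powers is in range.
    have h0 : 0 < Nat.clog 2 q := Nat.pos_of_ne_zero fun h0 => by simp [h0] at hc'
    have hlt : i % h % Nat.clog 2 q < Nat.clog 2 q := Nat.mod_lt _ h0
    have hval : τ bPow ((i : ℤ) % h % (Nat.clog 2 q)) = 2 ^ (i % h % Nat.clog 2 q) := by
      rw [hpow', ← hpow _ (by omega)]
      push_cast
      rfl
    have hp2 := F.two_pow_le (t := i % h % Nat.clog 2 q) (by omega)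
    refine Runs.store ?_ ?_ (by decide) ⟨agreeOff_write _ _ _ _, ?_⟩
    · simp [hi0]; omega
    · simp [hi0, Hτ.columns, Hτ.log_modulus, hval] at hp2 ⊢; omega
    · rw [flat_gadget hi, if_pos hc']
      simp [Mem.write_bank, hi0, Hτ.columns, Hτ.log_modulus, hval]
  · rw [hcond] at hc
    have hc' : ¬ (i % h / Nat.clog 2 q = i / h ∧ i % h < (g + 1) * Nat.clog 2 q) := by
      intro h0
      simp [h0] at hc
    refine Runs.store ?_ ?_ (by decide) ⟨agreeOff_write _ _ _ _, ?_⟩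
    · simp [hi0]; omega
    · simp
    · rw [flat_gadget hi, if_neg hc']
      simp [Mem.write_bank, hi0]

theorem runs_copyProg [NeZero q] (F : Fits b k n q g h) (H : HoldsCt k ct σ) {x y : Bank}
    {X : Ct q g h} (hX : IsFlat (σ y) X) (hx : x ≠ .param ∧ x ≠ .ct ∧ x ≠ bCell)
    (hy : y ≠ x ∧ y ≠ bCell) :
    Runs b (copyProg x y) σ ((g + 1) * h * 3 + 2) fun ρ =>
      AgreeOff [bCell, x] σ ρ ∧ IsFlat (ρ x) X := by
  have hb := F.bounds
  refine Runs.fill (X := []) (s := 1) _ _ (by omega) (by decide) (by simp [hx.2.2.symm])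
    (fun τ hτ => (H.congr hτ (by simp [hx.1.symm]) (by simp [hx.2.1.symm])).cells F) ?_
  intro i hi τ hi0 hτ _ _
  have hy' : τ y = σ y := hτ _ (by simp [hy])
  have hXi := hX i hi
  have hXb := abs_flat_lt X i
  refine Runs.store ?_ ?_ (by simp [Expr.size]) ⟨agreeOff_write _ _ _ _, ?_⟩
  · simp [hi0]; omega
  · simp only [Expr.loadsLe_load, Expr.loadsLe_const, Expr.val_const, Expr.val_load, hi0, hy', hXi]
    simp [abs_le, abs_lt] at hXb ⊢; omega
  · simp [Mem.write_bank, hi0, hy', hXi]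

/-- The literal of the `j`-th input bit in the circuit of the coordinate `i`. -/
def literal {l : ℕ} (i : ℕ) (j : Fin l) : Circuit l :=
  if i.testBit (j : ℕ) then .input j else .not (.input j)

theorem ediv_two_pow_emod_two_ne_zero (v t : ℕ) :
    (v : ℤ) / 2 ^ t % 2 ≠ 0 ↔ v.testBit t = true := by
  have : ((v : ℤ) / 2 ^ t % 2) = ((v / 2 ^ t % 2 : ℕ) : ℤ) := by push_cast; rfl
  rw [this, Nat.testBit_eq_decide_div_mod_eq]
  rcases Nat.mod_two_eq_zero_or_one (v / 2 ^ t) with h | h <;> simp [h]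

theorem runs_literalProg [NeZero q] (F : Fits b k n q g h) (H : HoldsCt k ct σ) (pk : Ct q g h)
    (hpow : ∀ t < Nat.clog 2 q + Nat.clog 2 n, σ bPow (t : ℕ) = 2 ^ t)
    (hgad : IsFlat (σ bGad) (gadget q g h)) {i : ℕ} (hi : i < n) (hcoord : σ bCoord 0 = i)
    {d : ℕ} (j : Fin (Nat.clog 2 n)) (hd : d + j + 1 = Nat.clog 2 n) (hround : σ bRound 0 = d) :
    Runs b literalProg σ ((g + 1) * h * 4 + 2) fun ρ =>
      AgreeOff [bCell, bLit] σ ρ ∧ IsFlat (ρ bLit) (gswEval pk ct (literal i j)) := by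
  have hb := F.bounds
  refine Runs.fill (X := []) (s := 2) _ _ (by omega) (by decide) (by decide)
    (fun τ hτ => (H.congr hτ).cells F) ?_
  intro p hp τ hp0 hτ _ _
  have Hτ := H.congr hτ
  have hpow' : τ bPow = σ bPow := hτ _ (by decide)
  have hgad' : τ bGad = σ bGad := hτ _ (by decide)
  have hcoord' : τ bCoord 0 = i := by rw [hτ _ (by decide), hcoord]
  have hround' : τ bRound 0 = d := by rw [hτ _ (by decide), hround]
  -- Round `d` treats bit `⌈log₂ n⌉ - 1 - d`, because the innermost conjunct of the fold is the last
  -- bit.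
  have hbit : ((Nat.clog 2 n : ℕ) : ℤ) - 1 - (d : ℤ) = (j : ℕ) := by omega
  have hbitval : τ bPow (j : ℕ) = 2 ^ (j : ℕ) := by rw [hpow', hpow _ (by omega)]
  have hbitle : eBit.LoadsLe τ b := by
    simp [Hτ.log_dim, hround']; omega
  have haddr : ((j : ℕ) : ℤ) * (((g : ℤ) + 1) * h) + p = ((j * ((g + 1) * h) + p : ℕ) : ℤ) := by
    push_cast; ring
  have hctval := Hτ.ct j p hp
  have hctb := abs_flat_lt (ct j) p
  have hgadval := hgad p hp
  have hgadb := abs_flat_lt (gadget q g h) p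
  have hp2 := F.two_pow_le (t := (j : ℕ)) (by omega)
  have hload : (Expr.load .ct (eBit * eCells + eVar bCell)).val τ = flat (ct j) p := by
    simp only [Expr.val_load, Expr.val_add, Expr.val_mul, Expr.val_sub, Expr.val_const,
      Hτ.log_dim, hround', hbit, Hτ.latticeDim, Hτ.columns, hp0, haddr, hctval]
  have hloadle : (Expr.load .ct (eBit * eCells + eVar bCell)).LoadsLe τ b := by
    refine ⟨⟨⟨hbitle, (Hτ.cells F).2⟩, ?_⟩, ?_⟩
    · simp [hp0]; omega
    · rw [Expr.val_load] at hload
      rw [hload]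
      omega
  have hcond : (eVar bCoord / .load bPow eBit % eNum 2).val τ = (i : ℤ) / 2 ^ (j : ℕ) % 2 := by
    simp [hcoord', Hτ.log_dim, hround', hbit, hbitval]
  refine Runs.ite ?_ (by decide) (fun hc => ?_) (fun hc => ?_)
  · rw [Expr.loadsLe_mod, Expr.loadsLe_div, Expr.loadsLe_load (e := eBit)]
    simp only [Expr.val_load, Expr.val_sub, Expr.val_const, Hτ.log_dim, hround', hbit, hbitval]
    refine ⟨⟨?_, hbitle, hp2⟩, ?_⟩
    · simp [hcoord']; omega
    · simp; omega
  · rw [hcond, ediv_two_pow_emod_two_ne_zero] at hc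
    refine Runs.store ?_ hloadle (by decide) ⟨agreeOff_write _ _ _ _, ?_⟩
    · simp [hp0]; omega
    · rw [hload]
      simp [Mem.write_bank, hp0, literal, hc, gswEval]
  · rw [hcond, ← not_ne_iff, ediv_two_pow_emod_two_ne_zero] at hc
    refine Runs.store ?_ ?_ (by decide) ⟨agreeOff_write _ _ _ _, ?_⟩
    · simp [hp0]; omega
    · rw [Expr.loadsLe_mod, Expr.loadsLe_sub]
      refine ⟨⟨?_, hloadle⟩, ?_⟩
      · simp only [Expr.loadsLe_load, Expr.loadsLe_const, Expr.val_load, Expr.val_const, hp0, hgad',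
          hgadval]
        simp; omega
      · simp [Hτ.modulus]; omega
    · rw [Expr.val_mod, Expr.val_sub, hload]
      simp only [Mem.write_bank, Expr.val_load, Expr.val_const, hp0, hgad', hgadval, Hτ.modulus]
      congr 1
      apply emod_eq_flat hp
      push_cast
      rw [intCast_flat _ hp, intCast_flat _ hp]
      simp [literal, hc, gswEval]

theorem runs_productProg [NeZero q] (F : Fits b k n q g h) (H : HoldsCt k ct σ)
    (hpow : ∀ t < Nat.clog 2 q + Nat.clog 2 n, σ bPow (t : ℕ) = 2 ^ t)
    {X Y : Ct q g h} (hX : IsFlat (σ bRes) X) (hY : IsFlat (σ bLit) Y) :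
    Runs b productProg σ ((g + 1) * h * (((g + 1) * Nat.clog 2 q * 3 + 4) + 2) + 2) fun ρ =>
      AgreeOff [bCell, bProd, bAcc, bCol] σ ρ ∧ IsFlat (ρ bProd) (Y * gadgetInv X) := by
  have hb := F.bounds
  have hqz : (0 : ℤ) < q := by exact_mod_cast Nat.pos_of_neZero q
  refine Runs.fill (X := [bAcc, bCol]) (s := _) _ _ (by omega) (by decide) (by decide)
    (fun τ hτ => (H.congr hτ).cells F) ?_
  intro p hp τ₀ hp0 hτ₀ _ _
  have hpd := div_lt_of_lt_cells hp
  have hpm := mod_lt_of_lt_cells hp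
  -- The unreduced partial inner product; after `m` rounds the accumulator holds `S m % q`.
  set S : ℕ → ℤ := fun m => ∑ j ∈ Finset.range m, flat Y (p / h * h + j) *
        (flat X (j / Nat.clog 2 q * h + p % h) / 2 ^ (j % Nat.clog 2 q) % 2) with hS
  have hbound : ∀ m, |S m % q| ≤ b := by
    intro m
    rw [abs_of_nonneg (Int.emod_nonneg _ hqz.ne')]
    have := Int.emod_lt_of_pos (S m) hqz
    omega
  rw [show (g + 1) * Nat.clog 2 q * 3 + 4 = 1 + (((g + 1) * Nat.clog 2 q * 3 + 2) + 1) by ring]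
  refine Runs.seq (P := fun τ => AgreeOff [bAcc] τ₀ τ ∧ τ bAcc 0 = 0) ?_ ?_
  · refine Runs.store (by simp) (by simp) (by decide) ⟨agreeOff_write _ _ _ _, ?_⟩
    simp [Mem.write_bank]
  rintro τ₁ ⟨hτ₁, hacc₁⟩
  refine Runs.seq (P := fun τ => AgreeOff [bAcc, bCol] τ₀ τ ∧
    τ bAcc 0 = S ((g + 1) * Nat.clog 2 q) % q) ?_ ?_
  · refine (Runs.for ((g + 1) * Nat.clog 2 q) (fun m τ => τ bCol 0 = m ∧
      AgreeOff [bAcc, bCol] τ₀ τ ∧ τ bAcc 0 = S m % q) (by omega) (by decide) ?_ ?_ ?_).mono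
      fun τ hτ => hτ.2
    · refine ⟨by simp [Mem.write_self],
        (hτ₁.mono (by simp)).trans ((agreeOff_write _ _ _ _).mono (by simp)), ?_⟩
      rw [Mem.write_ne _ _ _ (by decide), hacc₁]
      simp [hS]
    · rintro i - τ ⟨h1, h2, -⟩
      exact ⟨h1, ((H.congr hτ₀).congr h2).cols F⟩
    · rintro j hj τ ⟨h1, h2, h3⟩
      have h02 : AgreeOff [bCell, bProd, bAcc, bCol] σ τ := hτ₀.trans (h2.mono (by simp))
      have Hτ := H.congr h02
      have hL : 0 < Nat.clog 2 q := Nat.pos_of_ne_zero fun h0 => by simp [h0] at hj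
      have hjL : j / Nat.clog 2 q < g + 1 := Nat.div_lt_of_lt_mul (by rwa [mul_comm])
      have hjm : j % Nat.clog 2 q < Nat.clog 2 q := Nat.mod_lt _ hL
      have hjh : j < h := by have := F.cols_le; omega
      have hcell : τ bCell 0 = p := by rw [h2 _ (by decide), hp0]
      have hlit : τ bLit ((p : ℤ) / h * h + j) = flat Y (p / h * h + j) := by
        rw [h02 _ (by decide), ← hY _ (index_lt hpd hjh)]
        push_cast; rfl
      have hres : τ bRes ((j : ℤ) / (Nat.clog 2 q : ℕ) * h + (p : ℤ) % h) =
          flat X (j / Nat.clog 2 q * h + p % h) := by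
        rw [h02 _ (by decide), ← hX _ (index_lt hjL hpm)]
        push_cast; rfl
      have hpw : τ bPow ((j : ℤ) % (Nat.clog 2 q : ℕ)) = 2 ^ (j % Nat.clog 2 q) := by
        rw [h02 _ (by decide), ← hpow _ (by omega)]
        push_cast; rfl
      have hlitb := abs_flat_lt Y (p / h * h + j)
      have hresb := abs_flat_lt X (j / Nat.clog 2 q * h + p % h)
      have hpwb := F.two_pow_le (t := j % Nat.clog 2 q) (by omega)
      have hSb := hbound j
      refine Runs.store (by simp) ?_ (by decide) ⟨?_, ?_, ?_, ?_⟩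
      · simp only [Expr.loadsLe_mod, Expr.loadsLe_add, Expr.loadsLe_mul, Expr.loadsLe_div,
          Expr.loadsLe_load, Expr.loadsLe_const, Expr.val_add, Expr.val_mul, Expr.val_div,
          Expr.val_mod, Expr.val_load, Expr.val_const, h1, h3, hcell, Hτ.columns, Hτ.log_modulus,
          Hτ.modulus, hlit, hres, hpw, Nat.abs_cast]
        simp only [Nat.abs_ofNat, abs_zero, Nat.cast_le]
        omega
      · rw [Mem.write_ne _ _ _ (by decide), h1]
      · simp [Mem.write_self]
      · exact (h2.trans ((agreeOff_write _ _ _ _).mono (by simp))).trans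
          ((agreeOff_write _ _ _ _).mono (by simp))
      · rw [Mem.write_ne _ _ _ (by decide)]
        simp only [Mem.write_bank, Expr.val_add, Expr.val_mul, Expr.val_div,
          Expr.val_mod, Expr.val_load, Expr.val_const, h1, h3, hcell, Hτ.columns, Hτ.log_modulus,
          Hτ.modulus, hlit, hres, hpw, Function.update_self]
        rw [Int.emod_add_emod]
        simp only [hS, Finset.sum_range_succ]
  · rintro τ ⟨h1, h2⟩
    have hcell : τ bCell 0 = p := by rw [h1 _ (by decide), hp0]
    have hSb := hbound ((g + 1) * Nat.clog 2 q)
    refine Runs.store ?_ ?_ (by decide)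
      ⟨(h1.mono (by simp)).trans ((agreeOff_write _ _ _ _).mono (by simp)), ?_⟩
    · simp [hcell]; omega
    · simp [h2, hSb]
    · simp only [Mem.write_bank, Expr.val_load, Expr.val_const, hcell, h2]
      rw [h1 bProd (by decide), hS, flat_mul_gadgetInv F.cols_le X Y hp]

/-- The part of the circuit of the coordinate `i` that concerns the last `d` input bits. -/
def pointCircuitTail (l i d : ℕ) : Circuit l :=
  ((List.finRange l).drop (l - d)).foldr (fun j c => .and (literal i j) c) (.const true)

theorem pointCircuitTail_zero (l i : ℕ) : pointCircuitTail l i 0 = .const true := by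
  rw [pointCircuitTail, List.drop_of_length_le (by simp), List.foldr_nil]

/-- Lengthening the tail by one bit puts one conjunction outermost, which is what one round of
`evalProg` evaluates. -/
theorem pointCircuitTail_succ {l i d : ℕ} (j : Fin l) (hj : d + j + 1 = l) :
    pointCircuitTail l i (d + 1) = .and (literal i j) (pointCircuitTail l i d) := by
  have h1 : l - (d + 1) < (List.finRange l).length := by simp; omega
  have h2 : l - (d + 1) + 1 = l - d := by omega
  have h3 : (List.finRange l)[l - (d + 1)] = j := by
    ext; simp; omega
  rw [pointCircuitTail, List.drop_eq_getElem_cons h1, h2, h3]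
  rfl

theorem pointCircuitTail_self (l i : ℕ) : pointCircuitTail l i l = pointCircuit l i := by
  simp [pointCircuitTail, pointCircuit, literal]

/-- Number of instructions of `evalProg`. -/
def evalSteps (n q g h : ℕ) : ℕ :=
  ((Nat.clog 2 q + Nat.clog 2 n) * 4 + 2) + (((g + 1) * h * 4 + 2) + (((g + 1) * h * 3 + 2) +
    (Nat.clog 2 n * ((((g + 1) * h * 4 + 2) +
      (((g + 1) * h * (((g + 1) * Nat.clog 2 q * 3 + 4) + 2) + 2) + ((g + 1) * h * 3 + 2))) + 2) + 2)))

/-- Banks changed by `evalProg`. -/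
abbrev evalBanks : List Bank :=
  [bPow, bGad, bRes, bLit, bProd, bCell, bCol, bAcc, bRound]

theorem runs_evalProg [NeZero q] (F : Fits b k n q g h) (H : HoldsCt k ct σ) (pk : Ct q g h)
    {i : ℕ} (hi : i < n) (hcoord : σ bCoord 0 = i) :
    Runs b evalProg σ (evalSteps n q g h) fun ρ =>
      AgreeOff evalBanks σ ρ ∧
        IsFlat (ρ bRes) (gswEval pk ct (pointCircuit (Nat.clog 2 n) i)) := by
  have hb := F.bounds
  refine (runs_powProg F H).seq ?_
  rintro τ₁ ⟨hτ₁, hpow⟩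
  have H₁ := H.congr hτ₁
  refine (runs_gadgetProg F H₁ hpow).seq ?_
  rintro τ₂ ⟨hτ₂, hgad⟩
  have H₂ := H₁.congr hτ₂
  refine (runs_copyProg F H₂ hgad (by simp) (by simp)).seq ?_
  rintro τ₃ ⟨hτ₃, hres⟩
  have H₃ := H₂.congr hτ₃
  have hpow₃ : τ₃ bPow = τ₁ bPow := by rw [hτ₃ _ (by decide), hτ₂ _ (by decide)]
  have hgad₃ : τ₃ bGad = τ₂ bGad := hτ₃ _ (by decide)
  have hσ₃ : AgreeOff evalBanks σ τ₃ :=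
    ((hτ₁.mono (by simp)).trans (hτ₂.mono (by simp))).trans (hτ₃.mono (by simp))
  -- After `d` rounds `bRes` holds the evaluation of the conjunction over the last `d` bits; the
  -- start value `G` is the evaluation of the constant `1`.
  refine (Runs.for (Nat.clog 2 n) (fun d τ => τ bRound 0 = d ∧
    AgreeOff [bRes, bLit, bProd, bCell, bCol, bAcc, bRound] τ₃ τ ∧
    IsFlat (τ bRes) (gswEval pk ct (pointCircuitTail (Nat.clog 2 n) i d))) (by omega) (by decide)
    ?_ ?_ ?_).mono ?_
  · refine ⟨by simp [Mem.write_self], (agreeOff_write _ _ _ _).mono (by simp), ?_⟩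
    rw [Mem.write_ne _ _ _ (by decide), pointCircuitTail_zero]
    simpa [gswEval] using hres
  · rintro d - τ ⟨h1, h2, -⟩
    have Hτ := H₃.congr h2
    refine ⟨h1, by simp [Hτ.log_dim], ?_⟩
    simp [Hτ.log_dim]; omega
  · rintro d hd τ ⟨h1, h2, h3⟩
    have Hτ := H₃.congr h2
    have hjl : d + (Nat.clog 2 n - 1 - d) + 1 = Nat.clog 2 n := by omega
    refine (runs_literalProg F Hτ pk (i := i) (d := d) ?_ ?_ hi ?_
      ⟨Nat.clog 2 n - 1 - d, by omega⟩ hjl h1).seq ?_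
    · rw [h2 _ (by decide), hpow₃]; exact hpow
    · rw [h2 _ (by decide), hgad₃]; exact hgad
    · rw [h2 _ (by decide), hσ₃ _ (by decide), hcoord]
    rintro τ₄ ⟨hτ₄, hlit⟩
    have H₄ := Hτ.congr hτ₄
    refine (runs_productProg F H₄ ?_ (X := gswEval pk ct (pointCircuitTail (Nat.clog 2 n) i d))
      ?_ hlit).seq ?_
    · rw [hτ₄ _ (by decide), h2 _ (by decide), hpow₃]; exact hpow
    · rw [hτ₄ _ (by decide)]; exact h3
    rintro τ₅ ⟨hτ₅, hprod⟩
    have H₅ := H₄.congr hτ₅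
    refine (runs_copyProg F H₅ hprod (by simp) (by simp)).mono ?_
    rintro τ₆ ⟨hτ₆, hres⟩
    refine ⟨?_, by simp [Mem.write_self], ?_, ?_⟩
    · rw [hτ₆ _ (by decide), hτ₅ _ (by decide), hτ₄ _ (by decide), h1]
    · exact (((h2.trans (hτ₄.mono (by simp))).trans (hτ₅.mono (by simp))).trans
        (hτ₆.mono (by simp))).trans ((agreeOff_write _ _ _ _).mono (by simp))
    · rw [Mem.write_ne _ _ _ (by decide), pointCircuitTail_succ ⟨_, by omega⟩ hjl]
      exact hres
  · rintro τ ⟨-, h2, h3⟩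
    rw [pointCircuitTail_self] at h3
    exact ⟨hσ₃.trans (h2.mono (by simp)), h3⟩

end EvalProgram

/-! ### The programs for updates and reports -/

section Programs

/-- The sum computed by a report. -/
abbrev bTot : Bank := .work 10
abbrev bItem : Bank := .work 11
abbrev bFlag : Bank := .work 12

/-- Add `c` times the matrix in `bRes` to the matrix in `x`. -/
def accumProg (x : Bank) (c : Expr Bank) : Prog Bank :=
  .for bCell eCells
    (.store x (eVar bCell) ((.load x (eVar bCell) + c * .load bRes (eVar bCell)) % eQ))

/-- This runs after the call of the relaxed update and reads the outer input bank, which that call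
cannot change. -/
def updateTail : Prog Bank :=
  .seq (.store bCoord (eNum 0) (.load .input (eNum 0)))
    (.seq evalProg (accumProg .sketch (.load .input (eNum 1))))

/-- The program for updates. -/
def updateProg (A : StreamAlg₀) : Prog Bank :=
  .seq (.store (.sub .input) (eNum 0) (.load .input (eNum 0)))
    (.seq (.store (.sub .input) (eNum 1) (.load .input (eNum 1)))
      (.seq (A.update.map .sub) updateTail))

abbrev eCount : Expr Bank := .load (.sub .output) (eNum 0)
abbrev eItemCoord : Expr Bank := .load (.sub .output) (eNum 2 * eVar bItem + eNum 1)
abbrev eItemValue : Expr Bank := .load (.sub .output) (eNum 2 * eVar bItem + eNum 2)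

def totalProg : Prog Bank :=
  .seq (.for bCell eCells (.store bTot (eVar bCell) (eNum 0)))
    (.for bItem eCount
      (.seq (.store bCoord (eNum 0) eItemCoord) (.seq evalProg (accumProg bTot eItemValue))))

def compareProg : Prog Bank :=
  .seq (.store bFlag (eNum 0) (eNum 1))
    (.for bCell eCells
      (.store bFlag (eNum 0)
        (eVar bFlag * .bin .eq (.load bTot (eVar bCell)) (.load .sketch (eVar bCell)))))

def copyOutputProg : Prog Bank :=
  .seq (.store .output (eNum 0) eCount)
    (.for bItem eCount
      (.seq (.store .output (eNum 2 * eVar bItem + eNum 1) eItemCoord)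
        (.store .output (eNum 2 * eVar bItem + eNum 2) eItemValue)))

/-- The count is tested before any ciphertext is evaluated; this caps the number of evaluations by
`k`. -/
def reportTail : Prog Bank :=
  .ite (.bin .lt (ePar 1) eCount)
    (.store .output (eNum 0) (eNum (-1)))
    (.seq totalProg (.seq compareProg
      (.ite (eVar bFlag) copyOutputProg (.store .output (eNum 0) (eNum (-1))))))

/-- The program for reports. -/
def reportProg (A : StreamAlg₀) : Prog Bank :=
  .seq (A.report.map .sub) reportTail

variable {σ : Mem Bank} {b k n q g h : ℕ} {ct : Fin (Nat.clog 2 n) → Ct q g h}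

/-! ### Correctness and instruction counts of the update and report routines -/

theorem runs_accumProg [NeZero q] (F : Fits b k n q g h) (H : HoldsCt k ct σ) {x : Bank}
    {c : Expr Bank} {z : ℤ} {X Y : Ct q g h} (hX : IsFlat (σ x) X) (hY : IsFlat (σ bRes) Y)
    (hx : x ≠ .param ∧ x ≠ .ct ∧ x ≠ bCell ∧ x ≠ bRes) (hsize : c.size < 50)
    (hc : ∀ τ, AgreeOff [bCell, x] σ τ → c.val τ = z ∧ c.LoadsLe τ b) :
    Runs b (accumProg x c) σ ((g + 1) * h * 3 + 2) fun ρ =>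
      AgreeOff [bCell, x] σ ρ ∧ IsFlat (ρ x) (X + z • Y) := by
  have hb := F.bounds
  refine Runs.fill (X := []) (s := 1) _ _ (by omega) (by decide) (by simp [hx.2.2.1.symm])
    (fun τ hτ => (H.congr hτ (by simp [hx.1.symm]) (by simp [hx.2.1.symm])).cells F) ?_
  intro p hp τ hp0 hτ _ hun
  have Hτ := H.congr hτ (by simp [hx.1.symm]) (by simp [hx.2.1.symm])
  have hres : τ bRes p = flat Y p := by rw [hτ _ (by simp [hx.2.2.2.symm]), hY p hp]
  have hx' : τ x p = flat X p := by rw [hun, hX p hp]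
  have hXb := abs_flat_lt X p
  have hYb := abs_flat_lt Y p
  obtain ⟨hcv, hcl⟩ := hc τ hτ
  refine Runs.store ?_ ?_ ?_ ⟨agreeOff_write _ _ _ _, ?_⟩
  · simp [hp0]; omega
  · refine ⟨⟨?_, hcl, ?_⟩, ?_⟩
    · simp only [Expr.loadsLe_load, Expr.loadsLe_const, Expr.val_load, Expr.val_const, hp0, hx']
      simp; omega
    · simp only [Expr.loadsLe_load, Expr.loadsLe_const, Expr.val_load, Expr.val_const, hp0, hres]
      simp; omega
    · simp [Hτ.modulus]; omega
  -- The size depends on the variable expression `c`, so it is unfolded by hand.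
  · change 1 + 1 + (1 + 1 + 1 + (c.size + (1 + 1 + 1) + 1) + 1 + (1 + 1) + 1) < 100
    omega
  · simp only [Mem.write_bank, Expr.val_mod, Expr.val_add, Expr.val_mul, Expr.val_load,
      Expr.val_const, hp0, hx', hres, hcv, Hτ.modulus]
    congr 1
    apply emod_eq_flat hp
    push_cast
    rw [intCast_flat _ hp, intCast_flat _ hp]
    simp

/-- Number of instructions of `updateTail`. -/
def updateSteps (n q g h : ℕ) : ℕ := 1 + (evalSteps n q g h + ((g + 1) * h * 3 + 2))

theorem runs_updateTail [NeZero q] (F : Fits b k n q g h) (H : HoldsCt k ct σ) (pk : Ct q g h)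
    {X : Ct q g h} (hX : IsFlat (σ .sketch) X) {i : ℕ} (hi : i < n) {z : ℤ} (hz : |z| ≤ b)
    (hin₀ : σ .input 0 = i) (hin₁ : σ .input 1 = z) :
    Runs b updateTail σ (updateSteps n q g h) fun ρ =>
      AgreeOff (.sketch :: bCoord :: evalBanks) σ ρ ∧
        IsFlat (ρ .sketch) (X + z • gswEval pk ct (pointCircuit (Nat.clog 2 n) i)) := by
  have hb := F.bounds
  refine Runs.seq (P := fun τ => AgreeOff [bCoord] σ τ ∧ τ bCoord 0 = i) ?_ ?_
  · refine Runs.store (by simp) ?_ (by decide) ⟨agreeOff_write _ _ _ _, ?_⟩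
    · simp [hin₀]; omega
    · simp [Mem.write_bank, hin₀]
  rintro τ₁ ⟨hτ₁, hcoord⟩
  refine (runs_evalProg F (H.congr hτ₁) pk hi hcoord).seq ?_
  rintro τ₂ ⟨hτ₂, hres⟩
  have hsk : τ₂ .sketch = σ .sketch := by rw [hτ₂ _ (by decide), hτ₁ _ (by decide)]
  refine (runs_accumProg F ((H.congr hτ₁).congr hτ₂) (X := X) (z := z) (by rwa [hsk]) hres
    (by simp) (by decide) ?_).mono ?_
  · intro τ hτ
    have : τ .input = σ .input := by
      rw [hτ _ (by decide), hτ₂ _ (by decide), hτ₁ _ (by decide)]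
    constructor
    · simp [this, hin₁]
    · simp [this, hin₁, hz]; omega
  · rintro ρ ⟨h1, h2⟩
    exact ⟨((hτ₁.mono (by simp)).trans (hτ₂.mono (by simp))).trans (h1.mono (by simp)), h2⟩

/-- The banks changed by `totalProg`. -/
abbrev totalBanks : List Bank := bTot :: bItem :: bCoord :: evalBanks

def totalSteps (m n q g h : ℕ) : ℕ :=
  ((g + 1) * h * 3 + 2) + (m * ((1 + (evalSteps n q g h + ((g + 1) * h * 3 + 2))) + 2) + 2)

theorem runs_totalProg [NeZero q] (F : Fits b k n q g h) (H : HoldsCt k ct σ) (pk : Ct q g h)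
    {m : ℕ} (hm : m ≤ k) (e : Fin m → Fin n) (v : Fin m → ℤ) (hv : ∀ r, |v r| ≤ b)
    (hcount : σ (.sub .output) 0 = m)
    (hitem : ∀ r : Fin m, σ (.sub .output) (2 * (r : ℤ) + 1) = ((e r : ℕ) : ℤ) ∧
      σ (.sub .output) (2 * (r : ℤ) + 2) = v r) :
    Runs b totalProg σ (totalSteps m n q g h) fun ρ =>
      AgreeOff totalBanks σ ρ ∧
        IsFlat (ρ bTot) (∑ r, v r • gswEval pk ct (pointCircuit (Nat.clog 2 n) (e r))) := by
  have hb := F.bounds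
  -- The summands are extended by zero to all of `ℕ`, so that partial sums over `Finset.range` can
  -- serve as loop invariant.
  set G : ℕ → Ct q g h := fun r => if hr : r < m then
    v ⟨r, hr⟩ • gswEval pk ct (pointCircuit (Nat.clog 2 n) (e ⟨r, hr⟩)) else 0 with hG
  refine Runs.seq (P := fun τ => AgreeOff [bCell, bTot] σ τ ∧ IsFlat (τ bTot) (0 : Ct q g h)) ?_ ?_
  · refine Runs.fill (X := []) (s := 1) _ _ (by omega) (by decide) (by decide)
      (fun τ hτ => (H.congr hτ).cells F) ?_
    intro p hp τ hp0 hτ _ hun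
    refine Runs.store ?_ ?_ (by decide) ⟨agreeOff_write _ _ _ _, ?_⟩
    · simp [hp0]; omega
    · simp
    · simp [Mem.write_bank, hp0, flat]
  rintro τ₀ ⟨hτ₀, htot⟩
  refine (Runs.for m (fun r τ => τ bItem 0 = r ∧ AgreeOff totalBanks σ τ ∧
    IsFlat (τ bTot) (∑ r' ∈ Finset.range r, G r')) (by omega) (by decide) ?_ ?_ ?_).mono ?_
  · refine ⟨by simp [Mem.write_self],
      (hτ₀.mono (by simp)).trans ((agreeOff_write _ _ _ _).mono (by simp)), ?_⟩
    rw [Mem.write_ne _ _ _ (by decide)]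
    simpa using htot
  · rintro r - τ ⟨h1, h2, -⟩
    have hout : τ (.sub .output) = σ (.sub .output) := h2 _ (by decide)
    refine ⟨h1, by simp [hout, hcount], ?_⟩
    simp [hout, hcount]; omega
  · rintro r hr τ ⟨h1, h2, h3⟩
    have hout : τ (.sub .output) = σ (.sub .output) := h2 _ (by decide)
    obtain ⟨hi1, hi2⟩ := hitem ⟨r, hr⟩
    have hv' := hv ⟨r, hr⟩
    have her := (e ⟨r, hr⟩).2
    simp only at hi1 hi2
    have hbr : |(r : ℤ)| ≤ b := by rw [Nat.abs_cast]; omega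
    refine Runs.seq (P := fun ρ => AgreeOff [bCoord] τ ρ ∧ ρ bCoord 0 = (e ⟨r, hr⟩ : ℕ)) ?_ ?_
    · refine Runs.store (by simp) ?_ (by decide) ⟨agreeOff_write _ _ _ _, ?_⟩
      · simp [h1, hout, hi1]; omega
      · simp [Mem.write_bank, h1, hout, hi1]
    rintro τ₁ ⟨hτ₁, hcoord⟩
    have H₁ := (H.congr h2).congr hτ₁
    refine (runs_evalProg F H₁ pk her hcoord).seq ?_
    rintro τ₂ ⟨hτ₂, hres⟩
    have H₂ := H₁.congr hτ₂
    refine (runs_accumProg F H₂ (X := ∑ r' ∈ Finset.range r, G r') (z := v ⟨r, hr⟩)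
      (by rwa [hτ₂ _ (by decide), hτ₁ _ (by decide)]) hres (by simp) (by decide) ?_).mono ?_
    · intro ρ hρ
      have hout' : ρ (.sub .output) = σ (.sub .output) := by
        rw [hρ _ (by decide), hτ₂ _ (by decide), hτ₁ _ (by decide), hout]
      have hitem' : ρ bItem 0 = r := by
        rw [hρ _ (by decide), hτ₂ _ (by decide), hτ₁ _ (by decide), h1]
      constructor
      · simp [hitem', hout', hi2]
      · simp [hitem', hout', hi2, hv']; omega
    · rintro ρ ⟨h4, h5⟩
      refine ⟨?_, by simp [Mem.write_self], ?_, ?_⟩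
      · rw [h4 _ (by decide), hτ₂ _ (by decide), hτ₁ _ (by decide), h1]
      · exact (((h2.trans (hτ₁.mono (by simp))).trans (hτ₂.mono (by simp))).trans
          (h4.mono (by simp))).trans ((agreeOff_write _ _ _ _).mono (by simp))
      · rw [Mem.write_ne _ _ _ (by decide), Finset.sum_range_succ]
        simpa [hG, hr] using h5
  · rintro ρ ⟨-, h1, h2⟩
    refine ⟨h1, ?_⟩
    rw [Finset.sum_range] at h2
    simpa [hG] using h2

/-- The flag is the product of all cell comparisons. That it is `0` or `1` is recorded because the
subsequent conditional loads it. -/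
theorem runs_compareProg [NeZero q] (F : Fits b k n q g h) (H : HoldsCt k ct σ)
    {X Y : Ct q g h} (hX : IsFlat (σ bTot) X) (hY : IsFlat (σ .sketch) Y) :
    Runs b compareProg σ (1 + ((g + 1) * h * 3 + 2)) fun ρ =>
      AgreeOff [bCell, bFlag] σ ρ ∧ (ρ bFlag 0 = 0 ∨ ρ bFlag 0 = 1) ∧
        (ρ bFlag 0 ≠ 0 ↔ X = Y) := by
  classical
  have hb := F.bounds
  refine Runs.seq (P := fun τ => AgreeOff [bCell, bFlag] σ τ ∧ τ bFlag 0 = 1) ?_ ?_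
  · refine Runs.store (by simp) ?_ (by decide) ⟨(agreeOff_write _ _ _ _).mono (by simp), ?_⟩
    · simp; omega
    · simp [Mem.write_bank]
  rintro τ₀ ⟨hτ₀, hflag⟩
  refine (Runs.for ((g + 1) * h) (fun p τ => τ bCell 0 = p ∧ AgreeOff [bCell, bFlag] σ τ ∧
    τ bFlag 0 = if ∀ p' < p, σ bTot (p' : ℕ) = σ .sketch (p' : ℕ) then 1 else 0)
    (by omega) (by decide) ?_ ?_ ?_).mono ?_
  · refine ⟨by simp [Mem.write_self], hτ₀.trans ((agreeOff_write _ _ _ _).mono (by simp)), ?_⟩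
    rw [Mem.write_ne _ _ _ (by decide), hflag]
    simp
  · rintro p - τ ⟨h1, h2, -⟩
    exact ⟨h1, (H.congr h2).cells F⟩
  · rintro p hp τ ⟨h1, h2, h3⟩
    have hXp := hX p hp
    have hYp := hY p hp
    have hXb := abs_flat_lt X p
    have hYb := abs_flat_lt Y p
    have htot : τ bTot = σ bTot := h2 _ (by decide)
    have hsk : τ .sketch = σ .sketch := h2 _ (by decide)
    have hflagb : |τ bFlag 0| ≤ b := by
      rw [h3]; split_ifs <;> simp; omega
    refine Runs.store (by simp) ?_ (by decide) ⟨?_, ?_, ?_, ?_⟩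
    · simp only [Expr.loadsLe_mul, Expr.loadsLe_bin, Expr.loadsLe_load, Expr.loadsLe_const,
        Expr.val_load, Expr.val_const, h1, htot, hsk, hXp, hYp, abs_zero, Nat.abs_cast]
      omega
    · rw [Mem.write_ne _ _ _ (by decide), h1]
    · simp [Mem.write_self]
    · exact (h2.trans ((agreeOff_write _ _ _ _).mono (by simp))).trans
        ((agreeOff_write _ _ _ _).mono (by simp))
    · rw [Mem.write_ne _ _ _ (by decide)]
      simp only [Mem.write_bank, Expr.val_mul, Expr.val_eq, Expr.val_load, Expr.val_const, h1, htot,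
        hsk, h3, Function.update_self, Nat.forall_lt_succ_right]
      split_ifs <;> simp_all
  · rintro ρ ⟨-, h1, h2⟩
    refine ⟨h1, ?_, ?_⟩
    · rw [h2]; split_ifs <;> simp
    · rw [h2, ← hX.inj hY]
      split_ifs with h3 <;> simpa using h3

theorem runs_copyOutputProg (hb : k < b) {m : ℕ} (hm : m ≤ k) (hb2 : 2 ≤ b)
    (hcount : σ (.sub .output) 0 = m)
    (hle : ∀ r < m, |σ (.sub .output) (2 * (r : ℕ) + 1)| ≤ b ∧
      |σ (.sub .output) (2 * (r : ℕ) + 2)| ≤ b) :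
    Runs b copyOutputProg σ (1 + (m * 4 + 2)) fun ρ =>
      AgreeOff [bItem, .output] σ ρ ∧ ρ .output 0 = m ∧
        ∀ r < m, ρ .output (2 * (r : ℕ) + 1) = σ (.sub .output) (2 * (r : ℕ) + 1) ∧
          ρ .output (2 * (r : ℕ) + 2) = σ (.sub .output) (2 * (r : ℕ) + 2) := by
  refine Runs.seq (P := fun τ => AgreeOff [bItem, .output] σ τ ∧ τ .output 0 = m) ?_ ?_
  · refine Runs.store (by simp) ?_ (by decide) ⟨(agreeOff_write _ _ _ _).mono (by simp), ?_⟩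
    · simp [hcount]; omega
    · simp [Mem.write_bank, hcount]
  rintro τ₀ ⟨hτ₀, hcount'⟩
  refine (Runs.for m (fun i τ => τ bItem 0 = i ∧ AgreeOff [bItem, .output] σ τ ∧ τ .output 0 = m ∧
    ∀ r < i, τ .output (2 * (r : ℕ) + 1) = σ (.sub .output) (2 * (r : ℕ) + 1) ∧
      τ .output (2 * (r : ℕ) + 2) = σ (.sub .output) (2 * (r : ℕ) + 2))
    (by omega) (by decide) ?_ ?_ ?_).mono fun ρ hρ => hρ.2
  · refine ⟨by simp [Mem.write_self], hτ₀.trans ((agreeOff_write _ _ _ _).mono (by simp)), ?_, ?_⟩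
    · rw [Mem.write_ne _ _ _ (by decide), hcount']
    · simp
  · rintro i hi τ ⟨h1, h2, -⟩
    have hout : τ (.sub .output) = σ (.sub .output) := h2 _ (by decide)
    refine ⟨h1, by simp [hout, hcount], ?_⟩
    simp [hout, hcount]; omega
  · rintro i hi τ ⟨h1, h2, h3, h4⟩
    have hout : τ (.sub .output) = σ (.sub .output) := h2 _ (by decide)
    obtain ⟨hle1, hle2⟩ := hle i hi
    -- The intermediate memory is named exactly, since the second store overwrites a cell of the
    -- same bank. Later address comparisons use that `0`, `2r + 1` and `2r + 2` never collide for
    -- different items.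
    refine Runs.seq (s₁ := 1) (s₂ := 1) (P := fun ρ => ρ = τ.write .output (2 * (i : ℤ) + 1)
      (σ (.sub .output) (2 * (i : ℤ) + 1))) ?_ ?_
    · refine Runs.store ?_ ?_ (by decide) ?_
      · simp [h1]; omega
      · simp [h1, hout, hle1]; omega
      · simp [h1, hout]
    · rintro _ rfl
      have e1 : ∀ (x : Bank) (hx : x ≠ .output), τ.write .output (2 * (i : ℤ) + 1)
        (σ (.sub .output) (2 * (i : ℤ) + 1)) x = τ x := fun x hx => Mem.write_ne _ _ _ hx
      refine Runs.store ?_ ?_ (by decide) ⟨?_, ?_, ?_, ?_, ?_⟩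
      · simp [e1, h1]; omega
      · simp [e1, h1, hout, hle2]; omega
      · rw [Mem.write_ne _ _ _ (by decide), e1 _ (by decide), h1]
      · simp [Mem.write_self]
      · exact ((h2.trans ((agreeOff_write _ _ _ _).mono (by simp))).trans
          ((agreeOff_write _ _ _ _).mono (by simp))).trans ((agreeOff_write _ _ _ _).mono (by simp))
      · rw [Mem.write_ne _ _ _ (by decide)]
        simp only [Mem.write_bank, Expr.val_add, Expr.val_mul, Expr.val_load, Expr.val_const,
          e1 bItem (by decide), h1]
        rw [Function.update_of_ne (by omega), Function.update_of_ne (by omega), h3]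
      · intro r hr
        rw [Mem.write_ne _ _ _ (by decide)]
        simp only [Mem.write_bank, Expr.val_add, Expr.val_mul, Expr.val_load, Expr.val_const,
          e1 bItem (by decide), e1 (.sub .output) (by decide), h1, hout]
        rcases Nat.lt_succ_iff_lt_or_eq.1 hr with hr | rfl
        · rw [Function.update_of_ne (by omega), Function.update_of_ne (by omega),
            Function.update_of_ne (by omega), Function.update_of_ne (by omega)]
          exact h4 r hr
        · rw [Function.update_of_ne (by omega), Function.update_self, Function.update_self]
          exact ⟨rfl, rfl⟩

end Programs

/-! ### Correctness of whole operations on the stored data structure -/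

section Correctness

variable {σ : Mem Bank} {b k n q g h : ℕ}

theorem Holds.holdsCt {s : DS n q g h} (H : Holds k σ s) : HoldsCt k s.ct σ where
  sparsity := H.sparsity
  modulus := H.modulus
  latticeDim := H.latticeDim
  columns := H.columns
  log_dim := H.log_dim
  log_modulus := H.log_modulus
  ct j p hp := by
    rw [flat_of_lt _ hp, ← H.ct j]
    simp only [Nat.div_add_mod']

/-- Frame rule for the data structure: only the relaxed algorithm's banks and the sketch may change,
and input, output and working banks are irrelevant. -/
theorem Holds.congr {τ : Mem Bank} {s : DS n q g h} (H : Holds k σ s) {sub : Mem Bank₀}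
    {Y : Ct q g h} (hsub : ∀ x, τ (.sub x) = sub x) (hparam : τ .param = σ .param)
    (hpk : τ .pk = σ .pk) (hct : τ .ct = σ .ct) (hY : IsFlat (τ .sketch) Y) :
    Holds k τ (⟨sub, s.pk, s.ct, Y⟩ : DS n q g h) where
  sub := hsub
  dim := hparam ▸ H.dim
  sparsity := hparam ▸ H.sparsity
  modulus := hparam ▸ H.modulus
  latticeDim := hparam ▸ H.latticeDim
  columns := hparam ▸ H.columns
  log_dim := hparam ▸ H.log_dim
  log_modulus := hparam ▸ H.log_modulus
  pk := hpk ▸ H.pk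
  ct := hct ▸ H.ct
  sketch := isFlat_iff.1 hY

theorem sub_injective : Function.Injective Bank.sub := fun _ _ h => by injection h

/-- An update, apart from the call of the relaxed algorithm, takes `updateSteps + 2` instructions. -/
theorem exec_updateProg [NeZero q] {A : StreamAlg₀} (F : Fits b k n q g h) {s : DS n q g h}
    (H : Holds k σ s) (i : Fin n) {Δ : ℤ} (hΔ : |Δ| ≤ b) {sub : Mem Bank₀} {t₀ : ℕ}
    (hA : Exec A.update (writeInput .input s.sub (i : ℕ) Δ) sub t₀) :
    ∃ s' σ' t, UpdateStep A s i Δ s' t₀ ∧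
      Exec (updateProg A) (writeInput .input σ (i : ℕ) Δ) σ' t ∧ Holds k σ' s' ∧
      t ≤ (updateSteps n q g h + 2) * unitCost b + t₀ := by
  have hb := F.bounds
  have hi := i.2
  set σ₀ := writeInput .input σ (i : ℕ) Δ with hσ₀
  have hσ₀a : AgreeOff [.input] σ σ₀ :=
    (agreeOff_write _ _ _ _).trans (agreeOff_write _ _ _ _)
  have hin₀ : σ₀ .input 0 = (i : ℕ) := by simp [hσ₀, writeInput, Mem.write_bank]
  have hin₁ : σ₀ .input 1 = Δ := by simp [hσ₀, writeInput, Mem.write_bank]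
  obtain ⟨τ₁, t₁, hex₁, ht₁, rfl⟩ : Runs b (.store (.sub .input) (eNum 0) (.load .input (eNum 0)))
      σ₀ 1 fun τ => τ = σ₀.write (.sub .input) 0 (i : ℕ) := by
    refine Runs.store (by simp) ?_ (by decide) ?_
    · simp [hin₀]; omega
    · simp [hin₀]
  have hin₁' : σ₀.write (.sub .input) 0 (i : ℕ) .input = σ₀ .input :=
    Mem.write_ne _ _ _ (by decide)
  obtain ⟨τ₂, t₂, hex₂, ht₂, rfl⟩ : Runs b (.store (.sub .input) (eNum 1) (.load .input (eNum 1)))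
      (σ₀.write (.sub .input) 0 (i : ℕ)) 1
      fun τ => τ = (σ₀.write (.sub .input) 0 (i : ℕ)).write (.sub .input) 1 Δ := by
    refine Runs.store ?_ ?_ (by decide) ?_
    · simp; omega
    · simp [hin₁', hin₁, hΔ]; omega
    · simp [hin₁', hin₁]
  set σ₂ := (σ₀.write (.sub .input) 0 (i : ℕ)).write (.sub .input) 1 Δ with hσ₂
  have hσ₂a : AgreeOff [.sub .input] σ₀ σ₂ :=
    (agreeOff_write _ _ _ _).trans (agreeOff_write _ _ _ _)
  -- Seen through the embedding of banks, the memory is exactly the one on which the relaxed update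
  -- was assumed to run, so `Exec.map` applies.
  have hcomp : σ₂ ∘ Bank.sub = writeInput .input s.sub (i : ℕ) Δ := by
    funext x
    by_cases hx : x = .input
    · subst hx
      have : σ₀ (.sub .input) = s.sub .input := by rw [hσ₀a _ (by decide), H.sub]
      simp [hσ₂, writeInput, Mem.write_bank, this]
    · have h1 : σ₂ (.sub x) = s.sub x := by
        rw [hσ₂a _ (by simpa using hx), hσ₀a _ (by simp), H.sub]
      simp [writeInput, h1, Mem.write_ne _ _ _ hx]
  obtain ⟨τ, hexA, hτsub, hτ⟩ := hA.map sub_injective σ₂ hcomp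
  have hτσ : ∀ x : Bank, x ∉ Set.range Bank.sub → x ≠ .input → τ x = σ x := by
    intro x hx hx'
    rw [hτ x hx, hσ₂a x (by simp; rintro rfl; simp at hx), hσ₀a x (by simpa using hx')]
  have hparam := hτσ .param (by simp) (by simp)
  have hpk := hτσ .pk (by simp) (by simp)
  have hct := hτσ .ct (by simp) (by simp)
  have hsk := hτσ .sketch (by simp) (by simp)
  have hinput : τ .input = σ₀ .input := by rw [hτ _ (by simp), hσ₂a _ (by simp)]
  have Hτ : Holds k τ (⟨sub, s.pk, s.ct, s.sketch⟩ : DS n q g h) :=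
    H.congr (fun x => congrFun hτsub x) hparam hpk hct (by rw [hsk]; exact isFlat_iff.2 H.sketch)
  obtain ⟨ρ, u, hexT, hu, hρ, hρs⟩ := runs_updateTail F Hτ.holdsCt s.pk (isFlat_iff.2 Hτ.sketch) hi hΔ
    (by rw [hinput, hin₀]) (by rw [hinput, hin₁])
  refine ⟨⟨sub, s.pk, s.ct, s.sketch + Δ • s.ctHat i⟩, ρ, _, ⟨hA, rfl, rfl, rfl⟩,
    .seq hex₁ (.seq hex₂ (.seq hexA hexT)), ?_, ?_⟩
  · refine H.congr (fun x => ?_) ?_ ?_ ?_ hρs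
    · rw [hρ _ (by simp)]; exact congrFun hτsub x
    · rw [hρ _ (by decide), hparam]
    · rw [hρ _ (by decide), hpk]
    · rw [hρ _ (by decide), hct]
  · rw [add_mul]; omega

/-- Number of instructions of `reportTail`. -/
def reportSteps (k n q g h : ℕ) : ℕ :=
  totalSteps k n q g h + ((1 + ((g + 1) * h * 3 + 2)) + (1 + (k * 4 + 2) + 1)) + 1

/-- The list enumerates the support of `x` without repetition. Hence its length is the Hamming norm,
and the sum over all coordinates collapses to the sum over the list. -/
theorem runs_reportTail [NeZero q] (F : Fits b k n q g h) {ct : Fin (Nat.clog 2 n) → Ct q g h}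
    (H : HoldsCt k ct σ) (pk : Ct q g h) {Y : Ct q g h} (hY : IsFlat (σ .sketch) Y)
    {x : Fin n → ℤ} (hx : HoldsSparse (σ (.sub .output)) x) (hxb : ∀ i, |x i| ≤ b) :
    Runs b reportTail σ (reportSteps k n q g h) fun ρ =>
      AgreeOff (.output :: bFlag :: totalBanks) σ ρ ∧
      HoldsResponse (ρ .output) (if k < hammingNorm x then none
          else if ∑ i, x i • gswEval pk ct (pointCircuit (Nat.clog 2 n) i) = Y then some x
          else none) := by
  classical
  have hb := F.bounds
  obtain ⟨m, e, he, hxe, hcount, hitem⟩ := hx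
  have himage : (Finset.univ.filter fun i => x i ≠ 0) = Finset.univ.map ⟨e, he⟩ := by
    ext i; simpa using hxe i
  have hnorm : hammingNorm x = m := by
    rw [hammingNorm, himage]; simp
  -- The count is loaded before it is known to be at most `k`; injectivity bounds it by `n`, hence
  -- by `b`.
  have hmn : m ≤ n := by simpa using Fintype.card_le_of_injective e he
  have hsum : ∑ i, x i • gswEval pk ct (pointCircuit (Nat.clog 2 n) i) =
      ∑ r, x (e r) • gswEval pk ct (pointCircuit (Nat.clog 2 n) (e r)) := by
    have h1 := Finset.sum_map Finset.univ (⟨e, he⟩ : Fin m ↪ Fin n)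
      fun i => x i • gswEval pk ct (pointCircuit (Nat.clog 2 n) i)
    rw [← himage] at h1
    rw [← Finset.sum_filter_of_ne (p := fun i => x i ≠ 0), h1]
    · rfl
    · intro i _ hi h0
      exact hi (by simp [h0])
  rw [hnorm, hsum]
  have hcond : (Expr.bin .lt (ePar 1) eCount).val σ = if k < m then 1 else 0 := by
    simp [H.sparsity, hcount]
  refine Runs.ite ?_ (by decide) (fun hc => ?_) (fun hc => ?_)
  · simp [H.sparsity, hcount]; omega
  · have hkm : k < m := by
      by_contra h0
      simp [hcond, h0] at hc
    rw [if_pos hkm]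
    refine Runs.mono_steps (s₁ := 1) (Runs.store (by simp) ?_ (by decide)
      ⟨(agreeOff_write _ _ _ _).mono (by simp), ?_⟩) (by omega)
    · simp; omega
    · simp [HoldsResponse, Mem.write_bank]
  · have hkm : ¬ k < m := by
      intro h0
      simp [hcond, h0] at hc
    rw [if_neg hkm]
    have hmk : m ≤ k := by omega
    have hsteps : totalSteps m n q g h ≤ totalSteps k n q g h := by
      unfold totalSteps; gcongr
    refine ((runs_totalProg F H pk hmk e (fun r => x (e r)) (fun r => hxb _) hcount
      hitem).mono_steps hsteps).seq ?_
    rintro τ₁ ⟨hτ₁, htot⟩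
    refine (runs_compareProg F (H.congr hτ₁) htot (Y := Y) (by rwa [hτ₁ _ (by decide)])).seq ?_
    rintro τ₂ ⟨hτ₂, hflag, hflag'⟩
    have hout : τ₂ (.sub .output) = σ (.sub .output) := by
      rw [hτ₂ _ (by decide), hτ₁ _ (by decide)]
    have hσ₂ : AgreeOff (.output :: bFlag :: totalBanks) σ τ₂ :=
      (hτ₁.mono (by simp)).trans (hτ₂.mono (by simp))
    refine Runs.ite ?_ (by decide) (fun hc => ?_) (fun hc => ?_)
    · rcases hflag with h0 | h0 <;> simp [h0]; omega
    · rw [if_pos (hflag'.1 hc)]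
      refine ((runs_copyOutputProg (σ := τ₂) (b := b) (k := k) (by omega) hmk (by omega)
        (by rw [hout, hcount]) ?_).mono_steps (by omega)).mono ?_
      · intro r hr
        obtain ⟨h1, h2⟩ := hitem ⟨r, hr⟩
        simp only at h1 h2
        rw [hout, h1, h2]
        have := (e ⟨r, hr⟩).2
        exact ⟨by rw [Nat.abs_cast]; omega, hxb _⟩
      · rintro ρ ⟨h1, h2, h3⟩
        refine ⟨hσ₂.trans (h1.mono (by simp)), m, e, he, hxe, h2, fun r => ?_⟩
        obtain ⟨h4, h5⟩ := h3 r r.2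
        rw [h4, h5, hout]
        exact hitem r
    · rw [if_neg (fun h0 => hflag'.2 h0 hc)]
      refine Runs.mono_steps (s₁ := 1) (Runs.store (by simp) ?_ (by decide)
        ⟨hσ₂.trans ((agreeOff_write _ _ _ _).mono (by simp)), ?_⟩) (by omega)
      · simp; omega
      · simp [HoldsResponse, Mem.write_bank]

/-- A report, apart from the call of the relaxed algorithm, takes `reportSteps` instructions. -/
theorem exec_reportProg [NeZero q] {A : StreamAlg₀} (F : Fits b k n q g h) {s : DS n q g h}
    (H : Holds k σ s) {sub : Mem Bank₀} {t₀ : ℕ} (hA : Exec A.report s.sub sub t₀)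
    {x' : Fin n → ℤ} (hx' : HoldsSparse (sub .output) x') (hxb : ∀ i, |x' i| ≤ b) :
    ∃ s' r σ' t, ReportStep A k s s' r t₀ ∧ Exec (reportProg A) σ σ' t ∧ Holds k σ' s' ∧
      HoldsResponse (σ' .output) r ∧ t ≤ reportSteps k n q g h * unitCost b + t₀ := by
  obtain ⟨τ, hexA, hτsub, hτ⟩ := hA.map sub_injective σ (funext fun x => H.sub x)
  have hparam := hτ .param (by simp)
  have hpk := hτ .pk (by simp)
  have hct := hτ .ct (by simp)
  have hsk := hτ .sketch (by simp)
  have Hτ : Holds k τ (⟨sub, s.pk, s.ct, s.sketch⟩ : DS n q g h) :=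
    H.congr (fun x => congrFun hτsub x) hparam hpk hct (by rw [hsk]; exact isFlat_iff.2 H.sketch)
  have hout : τ (.sub .output) = sub .output := congrFun hτsub _
  obtain ⟨ρ, u, hexT, hu, hρ, hresp⟩ := runs_reportTail F Hτ.holdsCt s.pk (isFlat_iff.2 Hτ.sketch)
    (x := x') (by rwa [hout]) hxb
  refine ⟨⟨sub, s.pk, s.ct, s.sketch⟩, _, ρ, _, ⟨hA, rfl, rfl, rfl, x', hx', rfl⟩,
    .seq hexA hexT, ?_, hresp, by omega⟩
  refine H.congr (fun x => ?_) ?_ ?_ ?_ ?_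
  · rw [hρ _ (by simp)]; exact congrFun hτsub x
  · rw [hρ _ (by decide), hparam]
  · rw [hρ _ (by decide), hpk]
  · rw [hρ _ (by decide), hct]
  · rw [hρ _ (by decide)]; exact isFlat_iff.2 Hτ.sketch

/-! ### Storage -/

theorem cellBits_le {c : ℤ → ℤ} {m : ℕ} (hm : m ≤ b) (hc : ∀ a < m, |c (a : ℕ)| ≤ b) :
    cellBits c m ≤ m * (2 * Nat.size b + 1) := by
  unfold cellBits
  calc _ ≤ ∑ a ∈ Finset.range m, (2 * Nat.size b + 1) := by
        refine Finset.sum_le_sum fun a ha => ?_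
        rw [Finset.mem_range] at ha
        have h1 := bitLen_le_size (hc a ha)
        have h2 : bitLen (a : ℤ) ≤ Nat.size b := bitLen_le_size (by rw [Nat.abs_cast]; omega)
        omega
    _ = _ := by simp

theorem storedBits_le [NeZero q] (F : Fits b k n q g h) (hct : Nat.clog 2 n * ((g + 1) * h) ≤ b)
    {s : DS n q g h} (H : Holds k σ s) :
    storedBits n g h σ ≤
      ((Nat.clog 2 n + 2) * ((g + 1) * h) + 7) * (2 * Nat.size b + 1) := by
  have hb := F.bounds
  have hflat : ∀ {c : ℤ → ℤ} {X : Ct q g h}, IsFlat c X → ∀ a < (g + 1) * h, |c (a : ℕ)| ≤ b := by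
    intro c X hX a ha
    rw [hX a ha]
    have := abs_flat_lt X a
    omega
  have h1 := cellBits_le (b := b) (by omega) (hflat (isFlat_iff.2 H.pk))
  have h2 := cellBits_le (b := b) (by omega) (hflat (isFlat_iff.2 H.sketch))
  have h3 : cellBits (σ .ct) (Nat.clog 2 n * ((g + 1) * h)) ≤
      Nat.clog 2 n * ((g + 1) * h) * (2 * Nat.size b + 1) := by
    refine cellBits_le hct fun a ha => ?_
    have hpos : 0 < (g + 1) * h := Nat.pos_of_ne_zero fun h0 => by simp [h0] at ha
    have hj : a / ((g + 1) * h) < Nat.clog 2 n := Nat.div_lt_of_lt_mul (by rwa [mul_comm])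
    have := H.holdsCt.ct ⟨_, hj⟩ (a % ((g + 1) * h)) (Nat.mod_lt _ hpos)
    simp only [Nat.div_add_mod'] at this
    rw [this]
    have := abs_flat_lt (s.ct ⟨_, hj⟩) (a % ((g + 1) * h))
    omega
  have h4 : cellBits (σ .param) 7 ≤ 7 * (2 * Nat.size b + 1) := by
    refine cellBits_le (by omega) fun a ha => ?_
    have h0 := H.dim
    have h1 := H.sparsity
    have h2 := H.modulus
    have h3 := H.latticeDim
    have h4 := H.columns
    have h5 := H.log_dim
    have h6 := H.log_modulus
    interval_cases a <;> simp [h0, h1, h2, h3, h4, h5, h6] <;> omega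
  unfold storedBits
  nlinarith

/-! ### Reachable states -/

theorem Reach.bounded {A : StreamAlg₀} {N : ℕ} {x : Fin n → ℤ} {s : DS n q g h}
    (hr : Reach A k N x s) : Bounded N x := by
  induction hr with
  | setup _ => intro i; simp
  | update i Δ _ hb _ _ => exact hb
  | report _ _ ih => exact ih

/-- Within a run of the robust algorithm the relaxed one sees a legitimate stream, so its halting
and output guarantees are available at every state. -/
theorem Reach.relaxed {A : StreamAlg₀} {N : ℕ} {x : Fin n → ℤ} {s : DS n q g h}
    (hr : Reach A k N x s) : A.Reach n N x s.sub := by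
  induction hr with
  | setup hs => rw [hs.1]; exact .setup
  | update i Δ _ hb hu ih => exact .update i Δ ih hb hu.1
  | report _ hs ih => exact .report ih hs.1

theorem Bounded.abs_update_le {N : ℕ} {x : Fin n → ℤ} {i : Fin n} {Δ : ℤ} (hx : Bounded N x)
    (hx' : Bounded N (x + Pi.single i Δ)) : |Δ| ≤ 2 * N := by
  have h1 := hx i
  have h2 := hx' i
  simp only [Pi.add_apply, Pi.single_eq_same] at h2
  rw [abs_le] at *
  omega

end Correctness

/-! ### Asymptotics -/

section Asymptotics

variable {f f' : ℕ → ℕ} {F F' : ℕ → ℝ}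

theorem SoftO.of_le_mul (hf' : SoftO f' F) (C : ℝ) (hC : 0 ≤ C)
    (h : ∀ᶠ n in atTop, (f n : ℝ) ≤ C * f' n) : SoftO f F := by
  obtain ⟨C', d, h'⟩ := hf'
  refine ⟨C * C', d, ?_⟩
  filter_upwards [h, h'] with n h1 h2
  calc (f n : ℝ) ≤ C * f' n := h1
    _ ≤ C * (C' * F n * Real.log n ^ d) := by gcongr
    _ = _ := by ring

theorem SoftO.of_le (hf' : SoftO f' F) (h : ∀ᶠ n in atTop, f n ≤ f' n) : SoftO f F :=
  hf'.of_le_mul 1 zero_le_one (h.mono fun n hn => by rw [one_mul]; exact_mod_cast hn)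

/-- The constant in `SoftO` may be negative; passing to `|C|` together with `F ≥ 0` makes enlarging
`F` harmless. -/
theorem SoftO.mono (hf : SoftO f F) (hF : ∀ n, 0 ≤ F n) (h : ∀ᶠ n in atTop, F n ≤ F' n) :
    SoftO f F' := by
  obtain ⟨C, d, h'⟩ := hf
  refine ⟨|C|, d, ?_⟩
  filter_upwards [h, h', eventually_ge_atTop 1] with n h1 h2 h3
  have hlog : 0 ≤ Real.log n := Real.log_natCast_nonneg n
  refine h2.trans ?_
  have h4 : C * F n ≤ |C| * F' n :=
    (mul_le_mul_of_nonneg_right (le_abs_self C) (hF n)).trans (by gcongr)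
  gcongr

theorem SoftO.mul (hf : SoftO f F) (hf' : SoftO f' F') :
    SoftO (fun n => f n * f' n) (fun n => F n * F' n) := by
  obtain ⟨C, d, h⟩ := hf
  obtain ⟨C', d', h'⟩ := hf'
  refine ⟨C * C', d + d', ?_⟩
  filter_upwards [h, h'] with n h1 h2
  push_cast
  calc (f n : ℝ) * f' n ≤ (C * F n * Real.log n ^ d) * (C' * F' n * Real.log n ^ d') :=
        mul_le_mul h1 h2 (by positivity) ((Nat.cast_nonneg _).trans h1)
    _ = _ := by ring

theorem eventually_one_le_log : ∀ᶠ n : ℕ in atTop, 1 ≤ Real.log n :=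
  (Real.tendsto_log_atTop.comp tendsto_natCast_atTop_atTop).eventually_ge_atTop 1

theorem SoftO.add (hf : SoftO f F) (hf' : SoftO f' F) (hF : ∀ n, 0 ≤ F n) :
    SoftO (fun n => f n + f' n) F := by
  obtain ⟨C, d, h⟩ := hf
  obtain ⟨C', d', h'⟩ := hf'
  refine ⟨|C| + |C'|, d + d', ?_⟩
  filter_upwards [h, h', eventually_one_le_log] with n h1 h2 h3
  have hF := hF n
  have h4 : Real.log n ^ d ≤ Real.log n ^ (d + d') := pow_le_pow_right₀ h3 (by omega)
  have h5 : Real.log n ^ d' ≤ Real.log n ^ (d + d') := pow_le_pow_right₀ h3 (by omega)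
  have h6 : C * F n * Real.log n ^ d ≤ |C| * F n * Real.log n ^ (d + d') := by
    gcongr; exact le_abs_self C
  have h7 : C' * F n * Real.log n ^ d' ≤ |C'| * F n * Real.log n ^ (d + d') := by
    gcongr; exact le_abs_self C'
  push_cast
  linarith

theorem softO_const (c : ℕ) : SoftO (fun _ => c) (fun _ => 1) :=
  ⟨c, 0, by simp⟩

/-- `f` is eventually bounded by a power of `n`. -/
def EventuallyPoly (f : ℕ → ℕ) : Prop := ∃ c : ℕ, ∀ᶠ n in atTop, f n ≤ n ^ c

theorem EventuallyPoly.mono (hf : EventuallyPoly f') (h : ∀ᶠ n in atTop, f n ≤ f' n) :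
    EventuallyPoly f := by
  obtain ⟨c, hc⟩ := hf
  exact ⟨c, by filter_upwards [h, hc] with n h1 h2 using h1.trans h2⟩

theorem EventuallyPoly.add (hf : EventuallyPoly f) (hf' : EventuallyPoly f') :
    EventuallyPoly (fun n => f n + f' n) := by
  obtain ⟨c, hc⟩ := hf
  obtain ⟨d, hd⟩ := hf'
  refine ⟨c + d + 1, ?_⟩
  filter_upwards [hc, hd, eventually_ge_atTop 2] with n h1 h2 h3
  have h4 : n ^ c ≤ n ^ (c + d) := Nat.pow_le_pow_right (by omega) (by omega)
  have h5 : n ^ d ≤ n ^ (c + d) := Nat.pow_le_pow_right (by omega) (by omega)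
  have h6 : n ^ (c + d) * 2 ≤ n ^ (c + d + 1) := by rw [pow_succ]; gcongr
  omega

theorem EventuallyPoly.mul (hf : EventuallyPoly f) (hf' : EventuallyPoly f') :
    EventuallyPoly (fun n => f n * f' n) := by
  obtain ⟨c, hc⟩ := hf
  obtain ⟨d, hd⟩ := hf'
  refine ⟨c + d, ?_⟩
  filter_upwards [hc, hd] with n h1 h2
  rw [pow_add]
  exact Nat.mul_le_mul h1 h2

theorem eventuallyPoly_const (c : ℕ) : EventuallyPoly (fun _ => c) :=
  ⟨1, by filter_upwards [eventually_ge_atTop c] with n hn; simpa using hn⟩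

theorem eventuallyPoly_id : EventuallyPoly (fun n => n) := ⟨1, by simp⟩

theorem PolyBounded.eventuallyPoly (hf : PolyBounded f) : EventuallyPoly f := by
  obtain ⟨c, hc⟩ := hf
  have h1 : EventuallyPoly (fun n => n ^ c) := ⟨c, by simp⟩
  exact (h1.add (eventuallyPoly_const c)).mono (.of_forall hc)

theorem SoftO.eventuallyPoly {a : ℝ} (hf : SoftO f (fun n => (n : ℝ) ^ a)) : EventuallyPoly f := by
  obtain ⟨C, d, h⟩ := hf
  have h1 : EventuallyPoly (fun n => ⌈|C|⌉₊ * n ^ (⌈a⌉₊ + d)) :=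
    (eventuallyPoly_const _).mul ⟨_, .of_forall fun n => le_rfl⟩
  refine h1.mono ?_
  filter_upwards [h, eventually_ge_atTop 1] with n h2 h3
  have hn : (1 : ℝ) ≤ n := by exact_mod_cast h3
  have h4 : (n : ℝ) ^ a ≤ (n : ℝ) ^ ⌈a⌉₊ := by
    rw [← Real.rpow_natCast]
    exact Real.rpow_le_rpow_of_exponent_le hn (Nat.le_ceil a)
  have h5 : Real.log n ^ d ≤ (n : ℝ) ^ d := by
    have := Real.log_natCast_nonneg n
    gcongr
    exact Real.log_le_self (by positivity)
  have h6 : C ≤ (⌈|C|⌉₊ : ℝ) := (le_abs_self C).trans (Nat.le_ceil _)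
  have hlog : 0 ≤ Real.log n := Real.log_natCast_nonneg n
  have : (f n : ℝ) ≤ ⌈|C|⌉₊ * (n : ℝ) ^ (⌈a⌉₊ + d) := by
    calc (f n : ℝ) ≤ C * (n : ℝ) ^ a * Real.log n ^ d := h2
      _ ≤ ⌈|C|⌉₊ * (n : ℝ) ^ ⌈a⌉₊ * (n : ℝ) ^ d := by gcongr
      _ = _ := by rw [pow_add]; ring
  exact_mod_cast this

/-- The bit length of a polynomially bounded number is `O(log n)`. This makes the price of an
instruction polylogarithmic. -/
theorem EventuallyPoly.softO_size (hf : EventuallyPoly f) :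
    SoftO (fun n => Nat.size (f n)) (fun _ => 1) := by
  obtain ⟨c, hc⟩ := hf
  -- `2 ^ (size - 1) ≤ n ^ c` gives `size - 1 ≤ c log n / log 2 ≤ 2c log n`, and the remaining `1`
  -- is at most `log n`.
  refine ⟨2 * c + 1, 1, ?_⟩
  filter_upwards [hc, eventually_one_le_log, eventually_ge_atTop 1] with n h1 h2 h3
  have hn : (0 : ℝ) < n := by exact_mod_cast h3
  rcases Nat.eq_zero_or_pos (Nat.size (f n)) with h0 | h0
  · rw [h0]; simp; positivity
  have h4 : 2 ^ (Nat.size (f n) - 1) ≤ n ^ c := (Nat.lt_size.1 (by omega)).trans h1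
  have h5 : ((Nat.size (f n) - 1 : ℕ) : ℝ) * Real.log 2 ≤ c * Real.log n := by
    rw [← Real.log_pow, ← Real.log_pow]
    exact Real.log_le_log (by positivity) (by exact_mod_cast h4)
  rw [Nat.cast_sub h0] at h5
  have h6 := Real.log_two_gt_d9
  have h7 : (1 : ℝ) ≤ Nat.size (f n) := by exact_mod_cast h0
  push_cast at h5
  nlinarith

theorem clog_two_le_size (m : ℕ) : Nat.clog 2 m ≤ Nat.size m :=
  Nat.clog_le_of_le_pow (Nat.lt_size_self m).le

theorem log_le_size (m : ℕ) : Real.log m ≤ Nat.size m := by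
  rcases Nat.eq_zero_or_pos m with rfl | hm
  · simp
  have h1 : Real.log m ≤ Real.log ((2 : ℝ) ^ Nat.size m) :=
    Real.log_le_log (by exact_mod_cast hm) (by exact_mod_cast (Nat.lt_size_self m).le)
  rw [Real.log_pow] at h1
  have h2 := Real.log_two_lt_d9
  have h3 : (0 : ℝ) ≤ Nat.size m := by positivity
  nlinarith

theorem two_pow_clog_le {m : ℕ} (hm : 1 ≤ m) : 2 ^ Nat.clog 2 m ≤ 2 * m := by
  rcases Nat.eq_zero_or_pos (Nat.clog 2 m) with h0 | h0
  · rw [h0]; omega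
  · have := (Nat.lt_clog_iff_pow_lt (b := 2) (by norm_num)
      (y := Nat.clog 2 m - 1) (x := m)).1 (by omega)
    calc 2 ^ Nat.clog 2 m = 2 ^ (Nat.clog 2 m - 1) * 2 := by rw [← pow_succ]; congr 1; omega
      _ ≤ 2 * m := by omega

/-! ### Size of the step counts -/

/-- Up to a constant factor, a bound on `evalSteps`. -/
def stepBound (n q g h : ℕ) : ℕ :=
  ((g + 1) * h + 1) * ((g + 1) * Nat.clog 2 q + 1) * (Nat.clog 2 q + Nat.clog 2 n + 1)

theorem evalSteps_le (n q g h : ℕ) :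
    1 ≤ stepBound n q g h ∧ (g + 1) * h ≤ stepBound n q g h ∧
      evalSteps n q g h ≤ 100 * stepBound n q g h := by
  unfold stepBound evalSteps
  -- With the four quantities treated as independent, the claim compares polynomials with
  -- non-negative coefficients; `100` is a generous constant.
  generalize (g + 1) * h = c
  generalize (g + 1) * Nat.clog 2 q = d
  generalize Nat.clog 2 q = L
  generalize Nat.clog 2 n = l
  have h1 := Nat.zero_le (c * d)
  have h2 := Nat.zero_le (c * L)
  have h3 := Nat.zero_le (c * l)
  have h4 := Nat.zero_le (d * L)
  have h5 := Nat.zero_le (d * l)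
  have h6 := Nat.zero_le (c * d * L)
  have h7 := Nat.zero_le (c * d * l)
  refine ⟨?_, ?_, ?_⟩ <;> nlinarith

theorem updateSteps_le (n q g h : ℕ) : updateSteps n q g h + 2 ≤ 200 * stepBound n q g h := by
  obtain ⟨h1, h2, h3⟩ := evalSteps_le n q g h
  unfold updateSteps
  omega

/-- `k ≥ 1` lets the costs independent of the list (initialising, comparing) be absorbed into `k *
stepBound`. -/
theorem reportSteps_le {k : ℕ} (hk : 1 ≤ k) (n q g h : ℕ) :
    reportSteps k n q g h ≤ 300 * (k * stepBound n q g h) := by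
  obtain ⟨h1, h2, h3⟩ := evalSteps_le n q g h
  have h4 : stepBound n q g h ≤ k * stepBound n q g h := Nat.le_mul_of_pos_left _ hk
  have h5 : k ≤ k * stepBound n q g h := Nat.le_mul_of_pos_right _ h1
  have h6 : k * (1 + (evalSteps n q g h + ((g + 1) * h * 3 + 2)) + 2) ≤
      k * (110 * stepBound n q g h) := by gcongr; omega
  unfold reportSteps totalSteps
  rw [mul_left_comm] at h6
  omega

end Asymptotics

end WARStream

/-! ### The main theorem -/

theorem proposition4p6 (A₀ : StreamAlg₀) :
    ∃ update report : Prog Bank,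
      ∀ w₁ w₂ w₃ : ℝ, 0 < w₁ → 0 < w₂ → 0 < w₃ →
      ∃ w₀ : ℝ, 0 < w₀ ∧ ∀ w : ℝ, 0 < w → w ≤ w₀ →
      ∀ k N M q g h : ℕ → ℕ,
        (∀ n, 1 ≤ n → 1 ≤ k n ∧ k n ≤ n) →
        PolyBounded N → PolyBounded M → PolyBounded q →
        (∀ n, 1 ≤ n → n * N n < q n) →
        (∀ n, g n = ⌈(n : ℝ) ^ w⌉₊) →
        ((fun n => (h n : ℝ)) =Θ[atTop] fun n => (g n : ℝ) * Real.log (q n)) →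
        (∀ n, 1 ≤ n → (g n + 1) * Nat.clog 2 (q n) ≤ h n) →
        (∀ n, 1 ≤ n → A₀.SolvesRelaxed n (k n) (N n) (M n)) →
        ∃ S T₂ T₃ : ℕ → ℕ,
          SoftO S (fun n => (n : ℝ) ^ w₁) ∧
          SoftO T₂ (fun n => (n : ℝ) ^ w₂) ∧
          SoftO T₃ (fun n => (k n : ℝ) * (n : ℝ) ^ w₃) ∧
          ∀ n, 1 ≤ n → ∀ (x : Fin n → ℤ) (s : DS n (q n) (g n) (h n)),
            Reach A₀ (k n) (N n) x s → ∀ σ : Mem Bank, Holds (k n) σ s →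
              storedBits n (g n) (h n) σ ≤ S n ∧
              (∀ (i : Fin n) (Δ : ℤ), Bounded (N n) (x + Pi.single i Δ) →
                ∃ s' t₀ σ' t, UpdateStep A₀ s i Δ s' t₀ ∧
                  Exec update (writeInput .input σ (i : ℕ) Δ) σ' t ∧
                  Holds (k n) σ' s' ∧ t ≤ T₂ n + t₀) ∧
              (∃ s' r t₀ σ' t, ReportStep A₀ (k n) s s' r t₀ ∧
                Exec report σ σ' t ∧ Holds (k n) σ' s' ∧
                HoldsResponse (σ' .output) r ∧ t ≤ T₃ n + t₀) := by
  refine ⟨updateProg A₀, reportProg A₀, fun w₁ w₂ w₃ hw₁ hw₂ hw₃ =>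
    -- The factor `3` counts the factors `g + 1`, `h` and `g + 1` of `stepBound`, each of size
    -- `Õ(n^w)`.
    ⟨min w₁ (min w₂ w₃) / 3, by positivity, ?_⟩⟩
  intro w hw hw₀ k N M q g h hk hN hM hq hnq hg hh hcols hA
  have hww₁ : 3 * w ≤ w₁ := by linarith [min_le_left w₁ (min w₂ w₃)]
  have hww₂ : 3 * w ≤ w₂ := by
    linarith [(min_le_right w₁ (min w₂ w₃)).trans (min_le_left w₂ w₃)]
  have hww₃ : 3 * w ≤ w₃ := by
    linarith [(min_le_right w₁ (min w₂ w₃)).trans (min_le_right w₂ w₃)]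
  set P : ℕ → ℝ := fun n => (n : ℝ) ^ w with hP
  have hP0 : ∀ n, 0 ≤ P n := fun n => by positivity
  have hP1 : ∀ᶠ n in atTop, 1 ≤ P n := by
    filter_upwards [eventually_ge_atTop 1] with n hn
    exact Real.one_le_rpow (by exact_mod_cast hn) hw.le
  have hone : ∀ n : ℕ, (0 : ℝ) ≤ (fun _ => 1 : ℕ → ℝ) n := fun _ => zero_le_one
  have hgO : SoftO g P := by
    refine ⟨2, 0, ?_⟩
    filter_upwards [hP1] with n h1
    have := (Nat.ceil_lt_add_one (hP0 n)).le
    rw [hg n, pow_zero, mul_one]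
    linarith
  have hsq := hq.eventuallyPoly.softO_size
  have hLO : SoftO (fun n => Nat.clog 2 (q n)) (fun _ => 1) :=
    hsq.of_le (.of_forall fun n => clog_two_le_size _)
  have hlO : SoftO (fun n => Nat.clog 2 n) (fun _ => 1) :=
    eventuallyPoly_id.softO_size.of_le (.of_forall fun n => clog_two_le_size _)
  have hg1 : SoftO (fun n => g n + 1) P :=
    hgO.add ((softO_const 1).mono hone hP1) hP0
  have hhO : SoftO h P := by
    obtain ⟨C, hC0, hC⟩ := hh.1.exists_nonneg
    have h1 : SoftO (fun n => g n * Nat.size (q n)) P := by simpa using hgO.mul hsq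
    refine h1.of_le_mul C hC0 ?_
    filter_upwards [hC.bound] with n h2
    have hl0 : 0 ≤ Real.log (q n) := Real.log_natCast_nonneg _
    rw [Real.norm_of_nonneg (by positivity), Real.norm_of_nonneg (by positivity)] at h2
    push_cast
    refine h2.trans ?_
    gcongr
    exact log_le_size _
  have hcells : SoftO (fun n => (g n + 1) * h n + 1) (fun n => P n * P n) := by
    refine (hg1.mul hhO).add ((softO_const 1).mono hone ?_) fun n => mul_nonneg (hP0 n) (hP0 n)
    filter_upwards [hP1] with n h1 using one_le_mul_of_one_le_of_one_le h1 h1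
  have hcolsO : SoftO (fun n => (g n + 1) * Nat.clog 2 (q n) + 1) P :=
    SoftO.add (by simpa using hg1.mul hLO) ((softO_const 1).mono hone hP1) hP0
  have hlogs : SoftO (fun n => Nat.clog 2 (q n) + Nat.clog 2 n + 1) (fun _ => 1) :=
    (hLO.add hlO hone).add (softO_const 1) hone
  have hstep : SoftO (fun n => stepBound n (q n) (g n) (h n)) (fun n => P n * P n * P n) := by
    simpa [stepBound] using (hcells.mul hcolsO).mul hlogs
  -- A sum of everything that may be loaded: the first summands and `11` give the strict bound of
  -- `Fits`, `2N` covers `Δ`, `M` the reported entries, and the last term the addresses of the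
  -- stored ciphertexts.
  set b : ℕ → ℕ := fun n => n + k n + q n + g n + h n + (g n + 1) * h n +
    2 ^ (Nat.clog 2 (q n) + Nat.clog 2 n) + 11 + (2 * N n + M n) +
    Nat.clog 2 n * ((g n + 1) * h n) with hbdef
  have hbpoly : EventuallyPoly b := by
    have h1 := hg1.eventuallyPoly.mul hhO.eventuallyPoly
    have h2 : EventuallyPoly fun n => 2 ^ (Nat.clog 2 (q n) + Nat.clog 2 n) := by
      -- The largest power is polynomial because `2 ^ ⌈log₂ m⌉ ≤ 2m` for `m = q` and for `m = n`.
      refine ((((eventuallyPoly_const 2).mul hq.eventuallyPoly).mul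
        ((eventuallyPoly_const 2).mul eventuallyPoly_id))).mono ?_
      filter_upwards [eventually_ge_atTop 1] with n hn
      rw [pow_add]
      exact Nat.mul_le_mul (two_pow_clog_le (by have := hnq n hn; omega)) (two_pow_clog_le hn)
    have hkP : EventuallyPoly k := eventuallyPoly_id.mono (by
      filter_upwards [eventually_ge_atTop 1] with n hn using (hk n hn).2)
    have h3 : EventuallyPoly fun n => Nat.clog 2 n := eventuallyPoly_id.mono
      (.of_forall fun n => Nat.clog_le_of_le_pow Nat.lt_two_pow_self.le)
    exact ((((((((eventuallyPoly_id.add hkP).add hq.eventuallyPoly).add hgO.eventuallyPoly).add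
      hhO.eventuallyPoly).add h1).add h2).add (eventuallyPoly_const 11)).add
      (((eventuallyPoly_const 2).mul hN.eventuallyPoly).add hM.eventuallyPoly)).add (h3.mul h1)
  have hunit : SoftO (fun n => unitCost (b n)) (fun _ => 1) := by
    have h1 := hbpoly.softO_size.add (softO_const 1) hone
    simpa [unitCost, pow_two] using (softO_const 10000).mul (h1.mul h1)
  have hpow : ∀ {w' : ℝ}, 3 * w ≤ w' → ∀ᶠ n : ℕ in atTop, P n * P n * P n ≤ (n : ℝ) ^ w' := by
    intro w' hw'
    filter_upwards [eventually_ge_atTop 1] with n hn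
    have hn' : (1 : ℝ) ≤ n := by exact_mod_cast hn
    have hn0 : (0 : ℝ) < n := by linarith
    rw [hP, ← Real.rpow_add hn0, ← Real.rpow_add hn0]
    exact Real.rpow_le_rpow_of_exponent_le hn' (by linarith)
  have hP3 : ∀ n, 0 ≤ P n * P n * P n := fun n =>
    mul_nonneg (mul_nonneg (hP0 n) (hP0 n)) (hP0 n)
  refine ⟨fun n => ((Nat.clog 2 n + 2) * ((g n + 1) * h n) + 7) * (2 * Nat.size (b n) + 1),
    fun n => (updateSteps n (q n) (g n) (h n) + 2) * unitCost (b n),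
    fun n => reportSteps (k n) n (q n) (g n) (h n) * unitCost (b n), ?_, ?_, ?_, ?_⟩
  · have h1 : SoftO (fun n => 2 * Nat.size (b n) + 1) (fun _ => 1) := by
      refine SoftO.add ?_ (softO_const 1) hone
      simpa using (softO_const 2).mul hbpoly.softO_size
    have h2 : SoftO (fun n => (Nat.clog 2 n + 9) * ((g n + 1) * h n + 1)) (fun n => P n * P n) := by
      simpa using (hlO.add (softO_const 9) hone).mul hcells
    have h3 : SoftO (fun n => (Nat.clog 2 n + 9) * ((g n + 1) * h n + 1) *
        (2 * Nat.size (b n) + 1)) (fun n => P n * P n) := by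
      simpa using h2.mul h1
    refine SoftO.mono (h3.of_le (.of_forall fun n => ?_)) (fun n => mul_nonneg (hP0 n) (hP0 n)) ?_
    · gcongr
      nlinarith
    · filter_upwards [hpow hww₁, hP1] with n h4 h5
      exact le_trans (le_mul_of_one_le_right (mul_nonneg (hP0 n) (hP0 n)) h5) h4
  · have h1 : SoftO (fun n => 200 * stepBound n (q n) (g n) (h n) * unitCost (b n))
        (fun n => P n * P n * P n) := by
      simpa using ((softO_const 200).mul hstep).mul hunit
    refine SoftO.mono (h1.of_le (.of_forall fun n => ?_)) hP3 (hpow hww₂)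
    exact Nat.mul_le_mul_right _ (updateSteps_le _ _ _ _)
  · have hkO : SoftO k (fun n => (k n : ℝ)) := ⟨1, 0, by simp⟩
    have h1 : SoftO (fun n => 300 * (k n * stepBound n (q n) (g n) (h n)) * unitCost (b n))
        (fun n => k n * (P n * P n * P n)) := by
      simpa using ((softO_const 300).mul (hkO.mul hstep)).mul hunit
    refine SoftO.mono (h1.of_le ?_) (fun n => mul_nonneg (Nat.cast_nonneg _) (hP3 n)) ?_
    · filter_upwards [eventually_ge_atTop 1] with n hn
      exact Nat.mul_le_mul_right _ (reportSteps_le (hk n hn).1 _ _ _ _)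
    · filter_upwards [hpow hww₃] with n h2
      gcongr
  · intro n hn x s hr σ H
    have : NeZero (q n) := ⟨by have := hnq n hn; omega⟩
    have F : Fits (b n) (k n) n (q n) (g n) (h n) := ⟨hcols n hn, by simp only [hbdef]; omega⟩
    have hNM : 2 * N n ≤ b n ∧ M n ≤ b n ∧ Nat.clog 2 n * ((g n + 1) * h n) ≤ b n := by
      have := Nat.two_pow_pos (Nat.clog 2 (q n) + Nat.clog 2 n)
      simp only [hbdef]; omega
    refine ⟨storedBits_le F hNM.2.2 H, fun i Δ hΔ => ?_, ?_⟩
    · obtain ⟨sub, t₀, hex⟩ := (hA n hn).update_halts x s.sub hr.relaxed i Δ hΔ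
      have hΔ' := hr.bounded.abs_update_le hΔ
      -- Both the old and the new vector are bounded by `N`, so `|Δ| ≤ 2N ≤ b`.
      obtain ⟨s', σ', t, h1, h2, h3, h4⟩ := exec_updateProg F H i (by omega) hex
      exact ⟨s', t₀, σ', t, h1, h2, h3, h4⟩
    · obtain ⟨sub, t₀, x', hex, hx', hxb, -⟩ := (hA n hn).report_halts x s.sub hr.relaxed
      obtain ⟨s', r, σ', t, h1, h2, h3, h4, h5⟩ := exec_reportProg F H hex hx'
        fun i => (hxb i).trans (by exact_mod_cast hNM.2.1)
      exact ⟨s', r, t₀, σ', t, h1, h2, h3, h4, h5⟩
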